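/- Let $N\ge 3$. Let $D^{1,2}(\mathbb R^N)$ be the completion of $C_c^\infty(\mathbb R^N)$ in the norm $(\int|\nabla u|^2dx)^{1/2}$, realised as a subspace of $L^{2N/(N-2)}(\mathbb R^N)$. Let $V_\circ,V_1$ belong to the Lorentz space $L^{N/2,\infty}(\mathbb R^N)$, each positive on a set of positive measure, and suppose that the functional $u\mapsto\int_{\mathbb R^N}(V_1-V_\circ)u^2\,dx$ is weakly (sequentially) continuous on $D^{1,2}(\mathbb R^N)$. Put $$\Lambda_i=\inf\Big\{\int_{\mathbb R^N}|\nabla u|^2dx:\ u\in D^{1,2}(\mathbb R^N),\ \int_{\mathbb R^N}V_iu^2\,dx=1\Big\}\quad(i=\circ,1),\qquad Q_{V_\circ}(u)=\int_{\mathbb R^N}\big(|\nabla u|^2-\Lambda_\circ V_\circ u^2\big)dx\quad(u\in C_c^\infty(\mathbb R^N)).$$ A *null sequence* is a sequence of nonnegative functions $v_k\in C_c^\infty(\mathbb R^N)$ with $Q_{V_\circ}(v_k)\to0$ for which there is a nonnegative $\psi\in C_c^\infty(\mathbb R^N)$ with $\int\psi v_k\,dx=1$ for all $k$. A *positive ground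 state* of $Q_{V_\circ}$ is a function $v$ for which there is a closed set $Z\subset\mathbb R^N$ of capacity zero such that $v\in H^1_{\rm loc}(\mathbb R^N\setminus Z)$, $v>0$ a.e., $v$ is a weak solution of $-\Delta v-\Lambda_\circ V_\circ v=0$ in $\mathbb R^N\setminus Z$ (tested with $C_c^\infty(\mathbb R^N\setminus Z)$), and some null sequence converges to $v$ weakly in $H^1_{\rm loc}(\mathbb R^N\setminus Z)$; $\int|\nabla v|^2dx$ may be infinite. Assume that $Q_{V_\circ}$ has a positive ground state. (a) If every null sequence $(v_k)$ satisfies $\limsup_{k\to\infty}\int_{\mathbb R^N}(V_1-V_\circ)v_k^2\,dx>0$ (the value $+\infty$ being allowed), then $\Lambda_1<\Lambda_\circ$ and $\Lambda_1$ has a minimizer, i.e. there is $u\in D^{1,2}(\mathbb R^N)$ with $\int V_1u^2\,dx=1$ and $\int|\nabla u|^2dx=\Lambda_1$. (b) If $V_1\ge V_\circ$ a.e. on $\mathbb R^N$ with strict inequality on a set of positive measure, then $\limsup_{k\to\infty}\int(V_1-V_\circ)v_k^2\,dx>0$ for every null sequence that converges, weakly in $H^1_{\rm loc}(\mathbb R^N\setminus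 Z)$ for some closed $Z$ of capacity zero, to a positive ground state (a positive weak solution as above); and again $\Lambda_1<\Lambda_\circ$ and $\Lambda_1$ has a minimizer. -/

import Mathlib

open MeasureTheory Filter Topology
open scoped ENNReal ContDiff Gradient InnerProductSpace

noncomputable section

namespace HardyGS

/-- The Euclidean space `ℝ^N`. -/
abbrev RN (N : ℕ) : Type := EuclideanSpace ℝ (Fin N)

/-- `φ ∈ C_c^∞(Ω)`. -/
structure IsTest {N : ℕ} (Ω : Set (RN N)) (φ : RN N → ℝ) : Prop where
  smooth : ContDiff ℝ ∞ φ
  compact : HasCompactSupport φ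
  support : tsupport φ ⊆ Ω

/-- The distribution function `α_f(s) = |{x : |f x| > s}|`. -/
def distrib {N : ℕ} (f : RN N → ℝ) (s : ℝ≥0∞) : ℝ≥0∞ :=
  volume {x | s < ‖f x‖ₑ}

/-- The nonincreasing rearrangement `f^*(t) = inf {s > 0 : α_f(s) ≤ t}`. -/
def rearr {N : ℕ} (f : RN N → ℝ) (t : ℝ≥0∞) : ℝ≥0∞ :=
  sInf {s : ℝ≥0∞ | 0 < s ∧ distrib f s ≤ t}

/-- The Lorentz quasi-norm `sup_{t > 0} t^{1/p} f^*(t)` of `L^{p,∞}(ℝ^N)`, for `0 < p < ∞`. -/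
def lorentzQuasiNorm {N : ℕ} (p : ℝ) (f : RN N → ℝ) : ℝ≥0∞ :=
  ⨆ (t : ℝ) (_ : 0 < t), ENNReal.ofReal t ^ (1 / p) * rearr f (ENNReal.ofReal t)

/-- The Lorentz space `L^{p,∞}(ℝ^N)`. -/
structure MemLorentz {N : ℕ} (p : ℝ) (f : RN N → ℝ) : Prop where
  locallyIntegrable : LocallyIntegrable f volume
  finite : lorentzQuasiNorm p f < ⊤

/-- The critical Sobolev exponent `2N/(N-2)`, for `N ≥ 3`. -/
def sobolevExp (N : ℕ) : ℝ≥0∞ := ENNReal.ofReal (2 * (N : ℝ) / ((N : ℝ) - 2))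

/-- `u ∈ D^{1,2}(ℝ^N)` with gradient `G`. The completion of `C_c^∞(ℝ^N)` in the norm
`(∫ |∇φ|²)^{1/2}` is realised, by the Sobolev inequality, as a space of functions in
`L^{2N/(N-2)}`: `u` is the limit there of test functions whose gradients converge to `G` in
`L²`. The function `u` determines `G` almost everywhere (`G` is the weak gradient of `u`). -/
structure MemD12 {N : ℕ} (u : RN N → ℝ) (G : RN N → RN N) : Prop where
  memLp : MemLp u (sobolevExp N) volume
  memLp_grad : MemLp G 2 volume
  approx : ∃ φ : ℕ → RN N → ℝ, (∀ k, IsTest Set.univ (φ k)) ∧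
    Tendsto (fun k => eLpNorm (fun x => φ k x - u x) (sobolevExp N) volume) atTop (𝓝 0) ∧
    Tendsto (fun k => eLpNorm (fun x => ∇ (φ k) x - G x) 2 volume) atTop (𝓝 0)

/-- Weak convergence in the Hilbert space `D^{1,2}(ℝ^N)` (inner product `∫ ∇u · ∇w`) of a
sequence with gradients `Gk` to an element with gradient `G`. -/
def WeakConvD12 {N : ℕ} (Gk : ℕ → RN N → RN N) (G : RN N → RN N) : Prop :=
  ∀ (w : RN N → ℝ) (H : RN N → RN N), MemD12 w H →
    Tendsto (fun k => ∫ x, ⟪Gk k x, H x⟫_ℝ) atTop (𝓝 (∫ x, ⟪G x, H x⟫_ℝ))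

/-- The functional `u ↦ ∫ W u²` is weakly (sequentially) continuous in `D^{1,2}(ℝ^N)`. -/
def WeaklyContinuousD12 {N : ℕ} (W : RN N → ℝ) : Prop :=
  ∀ (uk : ℕ → RN N → ℝ) (Gk : ℕ → RN N → RN N) (u : RN N → ℝ) (G : RN N → RN N),
    (∀ k, MemD12 (uk k) (Gk k)) → MemD12 u G → WeakConvD12 Gk G →
    Tendsto (fun k => ∫ x, W x * uk k x ^ 2) atTop (𝓝 (∫ x, W x * u x ^ 2))

/-- `Λ_V = inf {∫ |∇u|² : u ∈ D^{1,2}(ℝ^N), ∫ V u² = 1}`. -/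
def Lam {N : ℕ} (V : RN N → ℝ) : ℝ :=
  sInf {t : ℝ | ∃ (u : RN N → ℝ) (G : RN N → RN N),
    MemD12 u G ∧ ∫ x, V x * u x ^ 2 = 1 ∧ t = ∫ x, ‖G x‖ ^ 2}

/-- `u` is a minimizer for `Λ_V`. -/
def IsMinimizer {N : ℕ} (V : RN N → ℝ) (u : RN N → ℝ) : Prop :=
  ∃ G : RN N → RN N, MemD12 u G ∧ ∫ x, V x * u x ^ 2 = 1 ∧ ∫ x, ‖G x‖ ^ 2 = Lam V

/-- `Q_V(u) = ∫ (|∇u|² - Λ_V V u²)` for `u ∈ C_c^∞(ℝ^N)`. -/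
def Q {N : ℕ} (V : RN N → ℝ) (u : RN N → ℝ) : ℝ :=
  ∫ x, (‖∇ u x‖ ^ 2 - Lam V * V x * u x ^ 2)

/-- A null sequence for `Q_V`. -/
structure IsNullSeq {N : ℕ} (V : RN N → ℝ) (vk : ℕ → RN N → ℝ) : Prop where
  test : ∀ k, IsTest Set.univ (vk k)
  nonneg : ∀ k x, 0 ≤ vk k x
  tendsto : Tendsto (fun k => Q V (vk k)) atTop (𝓝 0)
  normalized : ∃ ψ : RN N → ℝ, IsTest Set.univ ψ ∧ (∀ x, 0 ≤ ψ x) ∧ ∀ k, ∫ x, ψ x * vk k x = 1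

/-- The capacity `inf {∫ |∇u|² : u ∈ C_c^∞(ℝ^N), u ≥ 1 on K}` of a compact set `K`. -/
def cap {N : ℕ} (K : Set (RN N)) : ℝ :=
  sInf {t : ℝ | ∃ u : RN N → ℝ, IsTest Set.univ u ∧ (∀ x ∈ K, 1 ≤ u x) ∧ t = ∫ x, ‖∇ u x‖ ^ 2}

/-- `Z` is a closed set of capacity zero. -/
def IsClosedCapZero {N : ℕ} (Z : Set (RN N)) : Prop :=
  IsClosed Z ∧ ∀ K : Set (RN N), IsCompact K → K ⊆ Z → cap K = 0

/-- `v ∈ H^1_loc(Ω)` with weak gradient `G`. -/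
structure MemH1loc {N : ℕ} (Ω : Set (RN N)) (v : RN N → ℝ) (G : RN N → RN N) : Prop where
  memLp : ∀ K : Set (RN N), IsCompact K → K ⊆ Ω → MemLp v 2 (volume.restrict K)
  memLp_grad : ∀ K : Set (RN N), IsCompact K → K ⊆ Ω → MemLp G 2 (volume.restrict K)
  weak_grad : ∀ φ : RN N → ℝ, IsTest Ω φ → ∫ x, v x • ∇ φ x = - ∫ x, φ x • G x

/-- A positive weak solution `v ∈ H^1_loc(Ω)` of `-Δv - Λ_V V v = 0` in `Ω`, with weak
gradient `G`. -/
structure IsPosSolution {N : ℕ} (V : RN N → ℝ) (Ω : Set (RN N)) (v : RN N → ℝ)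
    (G : RN N → RN N) : Prop where
  memH1loc : MemH1loc Ω v G
  pos : ∀ᵐ x ∂(volume.restrict Ω), 0 < v x
  equation : ∀ φ : RN N → ℝ, IsTest Ω φ →
    ∫ x, ⟪G x, ∇ φ x⟫_ℝ = Lam V * ∫ x, V x * v x * φ x

/-- Weak convergence in `H^1_loc(Ω)` of the smooth functions `vk` to `v`, whose weak gradient
is `G`: the functions and their gradients converge weakly in `L²(K)` for every compact
`K ⊆ Ω`. -/
def WeakConvH1loc {N : ℕ} (Ω : Set (RN N)) (vk : ℕ → RN N → ℝ) (v : RN N → ℝ)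
    (G : RN N → RN N) : Prop :=
  ∀ K : Set (RN N), IsCompact K → K ⊆ Ω →
    (∀ g : RN N → ℝ, MemLp g 2 (volume.restrict K) →
      Tendsto (fun k => ∫ x in K, vk k x * g x) atTop (𝓝 (∫ x in K, v x * g x))) ∧
    (∀ F : RN N → RN N, MemLp F 2 (volume.restrict K) →
      Tendsto (fun k => ∫ x in K, ⟪∇ (vk k) x, F x⟫_ℝ) atTop (𝓝 (∫ x in K, ⟪G x, F x⟫_ℝ)))

/-- Outside the closed set `Z` of capacity zero, `v` is a positive solution of
`-Δv - Λ_V V v = 0` with weak gradient `G`, and `vk` is a null sequence for `Q_V` that converges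
to `v` weakly in `H^1_loc(ℝ^N \ Z)`. -/
structure IsGroundStateVia {N : ℕ} (V : RN N → ℝ) (Z : Set (RN N)) (v : RN N → ℝ)
    (G : RN N → RN N) (vk : ℕ → RN N → ℝ) : Prop where
  capZero : IsClosedCapZero Z
  solution : IsPosSolution V Zᶜ v G
  nullSeq : IsNullSeq V vk
  conv : WeakConvH1loc Zᶜ vk v G

/-- `v` is a positive (generalized) ground state of `Q_V`; its energy `∫ |∇v|²` may be infinite.
For example `|x|^{(2-N)/2}` for `V = 1/|x|²`, with `Z = {0}`. (Uniqueness of `v` up to a factor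
is not demanded, which admits, if anything, more ground states.) -/
def IsGroundState {N : ℕ} (V : RN N → ℝ) (v : RN N → ℝ) : Prop :=
  ∃ (Z : Set (RN N)) (G : RN N → RN N) (vk : ℕ → RN N → ℝ), IsGroundStateVia V Z v G vk

/-- `limsup_{k → ∞} ∫ W v_k²`, an extended real number. -/
def limsupInt {N : ℕ} (W : RN N → ℝ) (vk : ℕ → RN N → ℝ) : EReal :=
  limsup (fun k => ((∫ x, W x * vk k x ^ 2 : ℝ) : EReal)) atTop

end HardyGS

end

/-!
The argument is variational and needs no regularity theory for ground states.

*Form bounds.* A potential `V` in `L^{N/2,∞}` satisfies `∫ |V| u² ≤ K ∫ |∇u|²` on `D^{1,2}`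
(`MemLorentz.exists_formBounded`). For a test function `φ` this follows from Maz'ya's truncation
method (`exists_hardy_test`): the Sobolev inequality, applied to smooth truncations of `φ²` at the
levels `2^j`, bounds `∑ 2^j |{φ² ≥ 2^j}|^{1 - 2/N}` by the Dirichlet energy, while the Lorentz
condition gives `∫_A |V| ≤ C |A|^{1 - 2/N}` (`MemLorentz.exists_lintegral_le`). Hence `Λ_V > 0`
when `V > 0` on a set of positive measure, and `∫ V u w` is a bounded bilinear form on the Hilbert
space `D^{1,2}`, which is realised as the closed subspace `gradSpace` of `L²(ℝ^N; ℝ^N)` formed by the gradients.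

*Strict inequality.* Let `W = V₁ - V₀`. A null sequence satisfies
`∫ |∇v_k|² - Λ₀ ∫ V₁ v_k² = Q(v_k) - Λ₀ ∫ W v_k²`, and `Q(v_k) → 0`. If `limsup ∫ W v_k² > 0`, the
right-hand side is negative for some `k`, and `v_k` shows that `Λ₁ < Λ₀` (`lam_lt_of_isNullSeq`). Here
the ground state only provides a null sequence.

*Existence.* Since `∫ W u²` is weakly continuous and `Λ₁ < Λ₀`, a minimizing sequence for `Λ₁` cannot
lose mass in the weak limit (`exists_minimizer_of_lt`, `exists_isMinimizer_of_lam_lt`).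

*Ordered potentials.* A closed set `Z` of capacity zero is a null set by the Sobolev inequality.
So, if `W ≥ 0` is not zero almost everywhere, some compact `K` outside `Z` has positive measure and `W ≥ c > 0` on
`K`. Weak convergence gives `∫_K v_k → ∫_K v > 0`, which bounds `∫ W v_k² ≥ c ∫_K v_k²` from below
(`IsGroundStateVia.limsupInt_pos`).
-/

noncomputable section

open Set

namespace HardyGS

variable {N : ℕ}

/-! ### Test functions -/

/-- The Dirichlet energy `∫ ‖G‖²` of a vector field, as an extended nonnegative real. -/
def energy (G : RN N → RN N) : ℝ≥0∞ := ∫⁻ x, ‖G x‖ₑ ^ 2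

lemma eLpNorm_two_sq (G : RN N → RN N) : eLpNorm G 2 volume ^ 2 = energy G := by
  have h := eLpNorm_nnreal_pow_eq_lintegral (f := G) (μ := (volume : Measure (RN N)))
    (p := 2) (by norm_num)
  simp only [NNReal.coe_ofNat, ENNReal.rpow_ofNat, ENNReal.coe_ofNat] at h
  exact h

lemma norm_gradient (u : RN N → ℝ) (x : RN N) : ‖∇ u x‖ = ‖fderiv ℝ u x‖ := by
  simp [gradient]

namespace IsTest

variable {Ω : Set (RN N)} {φ ψ : RN N → ℝ}

lemma differentiable (h : IsTest Ω φ) : Differentiable ℝ φ := h.smooth.differentiable (by simp)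

lemma continuous (h : IsTest Ω φ) : Continuous φ := h.smooth.continuous

lemma continuous_gradient (h : IsTest Ω φ) : Continuous (∇ φ) :=
  (InnerProductSpace.toDual ℝ (RN N)).symm.continuous.comp (h.smooth.continuous_fderiv (by simp))

lemma compact_gradient (h : IsTest Ω φ) : HasCompactSupport (∇ φ) :=
  (h.compact.fderiv (𝕜 := ℝ)).comp_left (g := (InnerProductSpace.toDual ℝ (RN N)).symm) (map_zero _)

lemma memLp (h : IsTest Ω φ) (p : ℝ≥0∞) : MemLp φ p volume :=
  h.continuous.memLp_of_hasCompactSupport h.compact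

lemma memLp_gradient (h : IsTest Ω φ) (p : ℝ≥0∞) : MemLp (∇ φ) p volume :=
  h.continuous_gradient.memLp_of_hasCompactSupport h.compact_gradient

protected lemma zero : IsTest (univ : Set (RN N)) (fun _ => 0) :=
  ⟨contDiff_const, HasCompactSupport.zero, subset_univ _⟩

protected lemma add (h : IsTest univ φ) (h' : IsTest univ ψ) :
    IsTest univ (fun x => φ x + ψ x) :=
  ⟨h.smooth.add h'.smooth, h.compact.add h'.compact, subset_univ _⟩

protected lemma const_mul (c : ℝ) (h : IsTest univ φ) : IsTest univ (fun x => c * φ x) :=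
  ⟨contDiff_const.mul h.smooth, h.compact.mul_left (f := fun _ => c), subset_univ _⟩

lemma gradient_add (h : IsTest univ φ) (h' : IsTest univ ψ) (x : RN N) :
    ∇ (fun x => φ x + ψ x) x = ∇ φ x + ∇ ψ x := by
  simp only [gradient]
  rw [fderiv_fun_add (h.differentiable x) (h'.differentiable x), map_add]

lemma gradient_const_mul (c : ℝ) (h : IsTest univ φ) (x : RN N) :
    ∇ (fun x => c * φ x) x = c • ∇ φ x := by
  simp only [gradient]
  rw [fderiv_const_mul (h.differentiable x), LinearIsometryEquiv.map_smulₛₗ]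
  simp

end IsTest

/-! ### The Sobolev inequality -/

lemma sobolevExp_toReal (hN : 3 ≤ N) : (sobolevExp N).toReal = 2 * (N : ℝ) / ((N : ℝ) - 2) := by
  have : (3 : ℝ) ≤ N := by exact_mod_cast hN
  exact ENNReal.toReal_ofReal (div_nonneg (by linarith) (by linarith))

lemma sobolevExp_ne_top : sobolevExp N ≠ ⊤ := ENNReal.ofReal_ne_top

lemma one_le_sobolevExp (hN : 3 ≤ N) : 1 ≤ sobolevExp N := by
  have : (3 : ℝ) ≤ N := by exact_mod_cast hN
  rw [sobolevExp, ENNReal.one_le_ofReal, le_div_iff₀ (by linarith)]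
  linarith

lemma exists_sobolev_const (hN : 3 ≤ N) : ∃ S : NNReal, ∀ φ : RN N → ℝ, IsTest univ φ →
    eLpNorm φ (sobolevExp N) volume ≤ S * eLpNorm (∇ φ) 2 volume := by
  have h3 : (3 : ℝ) ≤ N := by exact_mod_cast hN
  refine ⟨SNormLESNormFDerivOfEqConst ℝ (volume : Measure (RN N)) (2 : NNReal), fun φ hφ => ?_⟩
  have h := eLpNorm_le_eLpNorm_fderiv_of_eq (volume : Measure (RN N)) (u := φ)
    (p := 2) (p' := (2 * (N : ℝ) / ((N : ℝ) - 2)).toNNReal)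
    (hφ.smooth.of_le (by simp)) hφ.compact (by norm_num) (by simp; omega) (by
      rw [Real.coe_toNNReal _ (div_nonneg (by linarith) (by linarith))]
      simp only [finrank_euclideanSpace, Fintype.card_fin, NNReal.coe_inv, NNReal.coe_ofNat]
      have : (N : ℝ) ≠ 0 := by linarith
      have : (N : ℝ) - 2 ≠ 0 := by linarith
      field_simp)
  have e : eLpNorm (fderiv ℝ φ) ((2 : NNReal) : ℝ≥0∞) volume = eLpNorm (∇ φ) 2 volume :=
    eLpNorm_congr_norm_ae (.of_forall fun x => (norm_gradient φ x).symm)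
  rw [e] at h
  exact h

/-- Sobolev and Chebyshev: a test function that is at least `1` on `A` has energy at least a
multiple of `|A|^{1 - 2/N}`. -/
lemma exists_measure_rpow_le_energy (hN : 3 ≤ N) : ∃ S : NNReal, ∀ (φ : RN N → ℝ) (A : Set (RN N)),
    IsTest univ φ → (∀ x ∈ A, 1 ≤ φ x) →
    volume A ^ (1 - 2 / (N : ℝ)) ≤ S * energy (∇ φ) := by
  have h3 : (3 : ℝ) ≤ N := by exact_mod_cast hN
  obtain ⟨S, hS⟩ := exists_sobolev_const hN
  refine ⟨S ^ 2, fun φ A hφ hA => ?_⟩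
  have h0 : sobolevExp N ≠ 0 := (zero_lt_one.trans_le (one_le_sobolevExp hN)).ne'
  have h1 := mul_meas_ge_le_pow_eLpNorm' (volume : Measure (RN N)) h0 sobolevExp_ne_top
    hφ.continuous.aestronglyMeasurable 1
  rw [ENNReal.one_rpow, one_mul, sobolevExp_toReal hN] at h1
  have h2 : volume A ≤ volume {x | 1 ≤ ‖φ x‖ₑ} := by
    refine measure_mono fun x hx => ?_
    have := hA x hx
    rw [mem_ofPred_eq, Real.enorm_eq_ofReal (by linarith), ENNReal.one_le_ofReal]
    exact this
  have hp : (0 : ℝ) ≤ 1 - 2 / (N : ℝ) := by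
    rw [sub_nonneg, div_le_one (by linarith)]; linarith
  calc volume A ^ (1 - 2 / (N : ℝ))
      ≤ (eLpNorm φ (sobolevExp N) volume ^ (2 * (N : ℝ) / ((N : ℝ) - 2))) ^ (1 - 2 / (N : ℝ)) :=
        ENNReal.rpow_le_rpow (h2.trans h1) hp
    _ = eLpNorm φ (sobolevExp N) volume ^ 2 := by
        rw [← ENNReal.rpow_mul, ← ENNReal.rpow_two]
        congr 1
        have : (N : ℝ) ≠ 0 := by linarith
        have : (N : ℝ) - 2 ≠ 0 := by linarith
        field_simp
    _ ≤ (S * eLpNorm (∇ φ) 2 volume) ^ 2 := by gcongr; exact hS φ hφ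
    _ = _ := by rw [mul_pow, eLpNorm_two_sq, ENNReal.coe_pow]

/-! ### Lorentz functions -/

lemma MemLorentz.aestronglyMeasurable {p : ℝ} {V : RN N → ℝ} (hV : MemLorentz p V) :
    AEStronglyMeasurable V volume := hV.locallyIntegrable.aestronglyMeasurable

/-- The weak-type bound `|{|V| > s}| ≤ (M / s)^p`. -/
lemma MemLorentz.exists_distrib_le {p : ℝ} (hp : 0 < p) {V : RN N → ℝ} (hV : MemLorentz p V) :
    ∃ M : ℝ, 0 < M ∧ ∀ s : ℝ, 0 < s →
      distrib V (ENNReal.ofReal s) ≤ ENNReal.ofReal ((M / s) ^ p) := by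
  refine ⟨(lorentzQuasiNorm p V).toReal + 1, by positivity, fun s hs => ?_⟩
  set M := (lorentzQuasiNorm p V).toReal + 1 with hM
  have hM0 : 0 < M := by positivity
  have hr0 : 0 < (M / s) ^ p := by positivity
  set t : ℝ := (M / s) ^ p with ht
  have htp : t ^ (1 / p) = M / s := by
    rw [ht, ← Real.rpow_mul (by positivity), mul_one_div_cancel hp.ne', Real.rpow_one]
  have h1 : ENNReal.ofReal t ^ (1 / p) * rearr V (ENNReal.ofReal t) ≤ lorentzQuasiNorm p V :=
    le_iSup₂ (f := fun (t : ℝ) (_ : 0 < t) =>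
      ENNReal.ofReal t ^ (1 / p) * rearr V (ENNReal.ofReal t)) t hr0
  rw [ENNReal.ofReal_rpow_of_pos hr0, htp] at h1
  have h2 : lorentzQuasiNorm p V < ENNReal.ofReal M := by
    rw [hM, ENNReal.ofReal_add ENNReal.toReal_nonneg zero_le_one, ENNReal.ofReal_toReal hV.finite.ne]
    exact ENNReal.lt_add_right hV.finite.ne (by simp)
  have h3 : rearr V (ENNReal.ofReal t) < ENNReal.ofReal s := by
    by_contra! hcon
    have : ENNReal.ofReal M ≤ ENNReal.ofReal (M / s) * rearr V (ENNReal.ofReal t) := by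
      calc ENNReal.ofReal M = ENNReal.ofReal (M / s) * ENNReal.ofReal s := by
            rw [← ENNReal.ofReal_mul (by positivity), div_mul_cancel₀ _ hs.ne']
        _ ≤ _ := by gcongr
    exact absurd (this.trans h1) (not_le.2 h2)
  obtain ⟨s', ⟨_, hs'⟩, hlt⟩ := sInf_lt_iff.1 h3
  exact (measure_mono fun x hx => lt_trans hlt hx).trans hs'

/-- A function in `L^{p,∞}`, `p > 1`, has integral at most a multiple of `|A|^{1 - 1/p}` over any
set `A`. -/
lemma MemLorentz.exists_lintegral_le {p : ℝ} (hp : 1 < p) {V : RN N → ℝ} (hV : MemLorentz p V) :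
    ∃ C : NNReal, ∀ A : Set (RN N), MeasurableSet A →
      ∫⁻ x in A, ‖V x‖ₑ ≤ C * volume A ^ (1 - 1 / p) := by
  have hp0 : 0 < p := by linarith
  obtain ⟨M, hM, hd⟩ := hV.exists_distrib_le hp0
  refine ⟨(M + M / (p - 1)).toNNReal, fun A hA => ?_⟩
  have hC : 0 < M + M / (p - 1) := by
    have : 0 < p - 1 := by linarith
    positivity
  have he : 0 < 1 - 1 / p := by
    rw [sub_pos, div_lt_one hp0]; exact hp
  rcases eq_or_ne (volume A) 0 with h0 | h0
  · rw [setLIntegral_measure_zero _ _ h0]; exact zero_le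
  rcases eq_or_ne (volume A) ⊤ with ht | ht
  · rw [ht, ENNReal.top_rpow_of_pos he, ENNReal.mul_top (by simpa using hC)]; exact le_top
  set a : ℝ := (volume A).toReal with ha
  have ha0 : 0 < a := ENNReal.toReal_pos h0 ht
  have hAa : volume A = ENNReal.ofReal a := (ENNReal.ofReal_toReal ht).symm
  -- the level at which the two bounds `|A|` and `(M / s)^p` for the distribution agree
  set s₀ : ℝ := M * a ^ (-(1 / p)) with hs₀
  have hs₀0 : 0 < s₀ := by positivity
  have hlayer : ∫⁻ x in A, ‖V x‖ₑ =
      ∫⁻ t in Ioi (0 : ℝ), volume.restrict A {x | t < |V x|} := by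
    rw [← lintegral_eq_lintegral_meas_lt _ (.of_forall fun x => abs_nonneg _)
      hV.aestronglyMeasurable.norm.aemeasurable.restrict]
    refine lintegral_congr fun x => ?_
    rw [← Real.norm_eq_abs, ofReal_norm]
  have hle1 : ∀ t : ℝ, volume.restrict A {x | t < |V x|} ≤ volume A := fun t =>
    (measure_mono (subset_univ _)).trans (by simp)
  have hle2 : ∀ t : ℝ, 0 < t →
      volume.restrict A {x | t < |V x|} ≤ ENNReal.ofReal (M ^ p * t ^ (-p)) := fun t ht => by
    refine (Measure.restrict_apply_le _ _).trans (le_trans (measure_mono fun x hx => ?_)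
      ((hd t ht).trans_eq ?_))
    · rw [mem_ofPred_eq, ← ofReal_norm, ENNReal.ofReal_lt_ofReal_iff_of_nonneg ht.le]
      exact hx
    · rw [Real.div_rpow hM.le ht.le, Real.rpow_neg ht.le, div_eq_mul_inv]
  rw [hlayer, ← Ioc_union_Ioi_eq_Ioi hs₀0.le,
    lintegral_union measurableSet_Ioi (by
      rw [Set.disjoint_left]; intro x hx hx'; exact absurd hx.2 (not_le.2 hx'))]
  have hb1 : ∫⁻ t in Ioc 0 s₀, volume.restrict A {x | t < |V x|} ≤ ENNReal.ofReal (s₀ * a) := by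
    calc _ ≤ ∫⁻ _ in Ioc 0 s₀, volume A := lintegral_mono fun t => hle1 t
      _ = _ := by
        rw [setLIntegral_const, Real.volume_Ioc, sub_zero, hAa, mul_comm,
          ← ENNReal.ofReal_mul hs₀0.le]
  have hb2 : ∫⁻ t in Ioi s₀, volume.restrict A {x | t < |V x|} ≤
      ENNReal.ofReal (M ^ p * (-s₀ ^ (-p + 1) / (-p + 1))) := by
    calc _ ≤ ∫⁻ t in Ioi s₀, ENNReal.ofReal (M ^ p * t ^ (-p)) :=
          setLIntegral_mono' measurableSet_Ioi fun t ht => hle2 t (hs₀0.trans ht)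
      _ = ENNReal.ofReal (∫ t in Ioi s₀, M ^ p * t ^ (-p)) := by
          rw [ofReal_integral_eq_lintegral_ofReal]
          · exact (integrableOn_Ioi_rpow_of_lt (by linarith) hs₀0).const_mul _
          · refine (ae_restrict_iff' measurableSet_Ioi).2 (.of_forall fun t ht => ?_)
            have : 0 < t := hs₀0.trans ht
            positivity
      _ = _ := by rw [integral_const_mul, integral_Ioi_rpow_of_lt (by linarith) hs₀0]
  refine (add_le_add hb1 hb2).trans_eq ?_
  have hp1 : 0 < p - 1 := by linarith
  have e1 : a ^ (1 - 1 / p) = a * a ^ (-(1 / p)) := by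
    rw [sub_eq_add_neg, Real.rpow_add ha0, Real.rpow_one]
  have e2 : M ^ p * s₀ ^ (-p + 1) = M * a ^ (1 - 1 / p) := by
    rw [hs₀, Real.mul_rpow hM.le (by positivity), ← mul_assoc, ← Real.rpow_add hM,
      ← Real.rpow_mul ha0.le]
    congr 1
    · rw [show p + (-p + 1) = 1 by ring, Real.rpow_one]
    · congr 1; field_simp; ring
  have e3 : M ^ p * (-s₀ ^ (-p + 1) / (-p + 1)) = M / (p - 1) * a ^ (1 - 1 / p) := by
    have : (-p + 1) = -(p - 1) := by ring
    rw [show M ^ p * (-s₀ ^ (-p + 1) / (-p + 1)) = (M ^ p * s₀ ^ (-p + 1)) * (-1 / (-p + 1)) by ring,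
      e2, this, neg_div_neg_eq]
    ring
  rw [e3, hAa, ENNReal.ofReal_rpow_of_pos ha0, ← ENNReal.ofReal_add (by positivity) (by positivity),
    ← ENNReal.ofReal, ← ENNReal.ofReal_mul hC.le]
  congr 1
  rw [e1, hs₀]; ring

/-! ### The Hardy-type inequality for test functions -/

/-- A smooth step function that is `0` on `(-∞, 1]` and `1` on `[3/2, ∞)`. It reaches the value
`1` before `2`, so that its derivative is supported in the half-open interval `[1, 2)`. -/
def smoothStep (s : ℝ) : ℝ := Real.smoothTransition (2 * (s - 1))

lemma contDiff_smoothStep : ContDiff ℝ ∞ smoothStep :=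
  Real.smoothTransition.contDiff.comp (contDiff_const.mul (contDiff_id.sub contDiff_const))

lemma smoothStep_eq_zero {s : ℝ} (hs : s ≤ 1) : smoothStep s = 0 :=
  Real.smoothTransition.zero_of_nonpos (by linarith)

lemma smoothStep_eq_one {s : ℝ} (hs : 3 / 2 ≤ s) : smoothStep s = 1 :=
  Real.smoothTransition.one_of_one_le (by linarith)

lemma deriv_smoothStep_eq_zero {s : ℝ} (hs : s ∉ Ico (1 : ℝ) 2) : deriv smoothStep s = 0 := by
  rw [mem_Ico, not_and_or, not_le, not_lt] at hs
  rcases hs with hs | hs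
  · have : smoothStep =ᶠ[𝓝 s] fun _ => 0 := by
      filter_upwards [Iio_mem_nhds hs] with t ht using smoothStep_eq_zero (le_of_lt ht)
    rw [this.deriv_eq, deriv_const]
  · have : smoothStep =ᶠ[𝓝 s] fun _ => 1 := by
      filter_upwards [Ioi_mem_nhds (show (3 / 2 : ℝ) < s by linarith)] with t ht
        using smoothStep_eq_one (le_of_lt ht)
    rw [this.deriv_eq, deriv_const]

lemma exists_deriv_smoothStep_le : ∃ L : ℝ, 0 ≤ L ∧ ∀ s, |deriv smoothStep s| ≤ L := by
  have hc : Continuous (deriv smoothStep) := contDiff_smoothStep.continuous_deriv (by simp)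
  obtain ⟨L, hL⟩ := (isCompact_Icc (a := (1 : ℝ)) (b := 2)).exists_bound_of_continuousOn
    hc.continuousOn
  refine ⟨max L 0, le_max_right _ _, fun s => ?_⟩
  by_cases hs : s ∈ Ico (1 : ℝ) 2
  · exact (hL s (Ico_subset_Icc_self hs)).trans (le_max_left _ _)
  · rw [deriv_smoothStep_eq_zero hs, abs_zero]; exact le_max_right _ _

/-- The truncation of `φ²` at the level `a` is a test function whose gradient is supported in
`{a ≤ φ² < 2a}` and controlled by the gradient of `φ`. -/
lemma IsTest.truncate {φ : RN N → ℝ} (hφ : IsTest univ φ) (a : ℝ) :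
    IsTest univ (fun x => smoothStep (φ x ^ 2 / a)) ∧
    ∀ x, ∇ (fun x => smoothStep (φ x ^ 2 / a)) x =
      (deriv smoothStep (φ x ^ 2 / a) * (2 * φ x / a)) • ∇ φ x := by
  have hs : ContDiff ℝ ∞ (fun x => φ x ^ 2 / a) := (hφ.smooth.pow 2).div_const a
  refine ⟨⟨contDiff_smoothStep.comp hs, ?_, subset_univ _⟩, fun x => ?_⟩
  · refine hφ.compact.comp_left (g := fun t : ℝ => smoothStep (t ^ 2 / a)) ?_
    exact smoothStep_eq_zero (by simp)
  · have hd : HasDerivAt smoothStep (deriv smoothStep (φ x ^ 2 / a)) (φ x ^ 2 / a) :=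
      (contDiff_smoothStep.differentiable (by simp) _).hasDerivAt
    have hp : HasDerivAt (fun t : ℝ => t ^ 2 / a) (2 * φ x / a) (φ x) := by
      simpa using (hasDerivAt_pow 2 (φ x)).div_const a
    have hc := (hd.comp (φ x) hp).comp_hasFDerivAt x (hφ.differentiable x).hasFDerivAt
    have := hc.fderiv
    simp only [gradient]
    rw [show (fun x => smoothStep (φ x ^ 2 / a)) =
      (smoothStep ∘ fun t : ℝ => t ^ 2 / a) ∘ φ from rfl, this, LinearIsometryEquiv.map_smulₛₗ]
    simp

/-- If `∫_A |V| ≤ C |A|^{1 - 2/N}` for all `A`, then `∫ |V| φ² ≤ C' ∫ |∇φ|²` for test functions.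
The smooth truncations of `φ²` at the levels `2^j` have gradients with disjoint supports; the
Sobolev inequality for each of them bounds `2^j |{φ² ≥ 2^{j+1}}|^{1 - 2/N}` by the energy of `φ` in
`{2^j ≤ φ² < 2^{j+1}}`, and these bounds are summed over `j`. -/
lemma exists_hardy_test (hN : 3 ≤ N) {V : RN N → ℝ} {C : NNReal}
    (hC : ∀ A : Set (RN N), MeasurableSet A → ∫⁻ x in A, ‖V x‖ₑ ≤ C * volume A ^ (1 - 2 / (N : ℝ))) :
    ∃ K : NNReal, ∀ φ : RN N → ℝ, IsTest univ φ →
      ∫⁻ x, ‖V x‖ₑ * ‖φ x‖ₑ ^ 2 ≤ K * energy (∇ φ) := by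
  obtain ⟨S, hS⟩ := exists_measure_rpow_le_energy hN
  obtain ⟨L, hL0, hL⟩ := exists_deriv_smoothStep_le
  refine ⟨4 * C * S * (8 * L ^ 2).toNNReal, fun φ hφ => ?_⟩
  set R : ℤ → Set (RN N) := fun j => {x | φ x ^ 2 ∈ Ico ((2 : ℝ) ^ j) (2 ^ (j + 1))} with hR
  have hφc : Continuous fun x => φ x ^ 2 := hφ.continuous.pow 2
  have hRm : ∀ j, MeasurableSet (R j) := fun j => hφc.measurable measurableSet_Ico
  have hRd : Pairwise (Function.onFun Disjoint R) := by
    intro i j hij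
    have : Disjoint (Ico ((2 : ℝ) ^ i) (2 ^ (i + 1))) (Ico ((2 : ℝ) ^ j) (2 ^ (j + 1))) := by
      have := (zpow_right_mono₀ (one_le_two (α := ℝ))).pairwise_disjoint_on_Ico_succ hij
      simpa [Function.onFun, Order.succ_eq_add_one] using this
    exact this.preimage (fun x => φ x ^ 2)
  have hpos : ∀ j : ℤ, (0 : ℝ) < 2 ^ j := fun j => by positivity
  have hsucc : ∀ j : ℤ, (2 : ℝ) ^ (j + 1) = 2 * 2 ^ j := fun j => by
    rw [zpow_add_one₀ (by norm_num), mul_comm]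
  -- the Sobolev inequality for the truncation at the level `2 ^ j`
  have hlevel : ∀ j : ℤ, ENNReal.ofReal (2 ^ j) *
      volume {x | (2 : ℝ) ^ (j + 1) ≤ φ x ^ 2} ^ (1 - 2 / (N : ℝ)) ≤
      S * ((8 * L ^ 2).toNNReal * ∫⁻ x in R j, ‖∇ φ x‖ₑ ^ 2) := by
    intro j
    obtain ⟨ht, hg⟩ := hφ.truncate (2 ^ j)
    have h1 := hS _ {x | (2 : ℝ) ^ (j + 1) ≤ φ x ^ 2} ht (fun x hx => by
      rw [mem_ofPred_eq, hsucc] at hx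
      refine (smoothStep_eq_one ?_).ge
      rw [le_div_iff₀ (hpos j)]
      have := hpos j
      linarith)
    have h2 : ENNReal.ofReal (2 ^ j) * energy (∇ fun x => smoothStep (φ x ^ 2 / 2 ^ j)) ≤
        (8 * L ^ 2).toNNReal * ∫⁻ x in R j, ‖∇ φ x‖ₑ ^ 2 := by
      rw [energy, ← lintegral_indicator (hRm j), ← lintegral_const_mul' _ _ ENNReal.ofReal_ne_top,
        ← lintegral_const_mul' _ _ ENNReal.coe_ne_top]
      refine lintegral_mono fun x => ?_
      dsimp only
      rw [hg x, enorm_smul, mul_pow]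
      by_cases hx : x ∈ R j
      · rw [indicator_of_mem hx, ← mul_assoc]
        gcongr
        rw [Real.enorm_eq_ofReal_abs, ← ENNReal.ofReal_pow (abs_nonneg _),
          ← ENNReal.ofReal_mul (hpos j).le, ← ENNReal.ofReal]
        refine ENNReal.ofReal_le_ofReal ?_
        rw [sq_abs, mul_pow, div_pow, mul_pow]
        have hx2 : φ x ^ 2 ≤ 2 * 2 ^ j := by rw [← hsucc]; exact hx.2.le
        have hd : deriv smoothStep (φ x ^ 2 / 2 ^ j) ^ 2 ≤ L ^ 2 := by
          rw [← sq_abs]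
          exact pow_le_pow_left₀ (abs_nonneg _) (hL _) 2
        have hj := hpos j
        have e : (2 : ℝ) ^ j * (deriv smoothStep (φ x ^ 2 / 2 ^ j) ^ 2 *
            (2 ^ 2 * φ x ^ 2 / (2 ^ j) ^ 2)) =
            deriv smoothStep (φ x ^ 2 / 2 ^ j) ^ 2 * (4 * (φ x ^ 2 / 2 ^ j)) := by
          field_simp; ring
        rw [e]
        have hq : φ x ^ 2 / 2 ^ j ≤ 2 := by rw [div_le_iff₀ hj]; exact hx2
        calc deriv smoothStep (φ x ^ 2 / 2 ^ j) ^ 2 * (4 * (φ x ^ 2 / 2 ^ j))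
            ≤ L ^ 2 * (4 * 2) := by gcongr
          _ = 8 * L ^ 2 := by ring
      · rw [indicator_of_notMem hx, deriv_smoothStep_eq_zero]
        · simp
        · intro h
          refine hx ?_
          rw [mem_Ico, le_div_iff₀ (hpos j), div_lt_iff₀ (hpos j), one_mul] at h
          refine ⟨h.1, ?_⟩
          rw [hsucc]; exact h.2
    calc _ ≤ ENNReal.ofReal (2 ^ j) * (S * energy (∇ fun x => smoothStep (φ x ^ 2 / 2 ^ j))) := by
          gcongr
      _ = S * (ENNReal.ofReal (2 ^ j) * energy (∇ fun x => smoothStep (φ x ^ 2 / 2 ^ j))) := by ring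
      _ ≤ _ := by gcongr
  -- the part of `∫ |V| φ²` over the ring `R (j + 1)`
  have hring : ∀ j : ℤ, ∫⁻ x in R (j + 1), ‖V x‖ₑ * ‖φ x‖ₑ ^ 2 ≤
      (4 * C * S * (8 * L ^ 2).toNNReal : NNReal) * ∫⁻ x in R j, ‖∇ φ x‖ₑ ^ 2 := by
    intro j
    have hm : MeasurableSet {x | (2 : ℝ) ^ (j + 1) ≤ φ x ^ 2} :=
      hφc.measurable measurableSet_Ici
    calc ∫⁻ x in R (j + 1), ‖V x‖ₑ * ‖φ x‖ₑ ^ 2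
        ≤ ∫⁻ x in R (j + 1), ENNReal.ofReal (4 * 2 ^ j) * ‖V x‖ₑ := by
          refine setLIntegral_mono' (hRm _) fun x hx => ?_
          rw [mul_comm]
          gcongr
          rw [Real.enorm_eq_ofReal_abs, ← ENNReal.ofReal_pow (abs_nonneg _), sq_abs]
          refine ENNReal.ofReal_le_ofReal (hx.2.le.trans_eq ?_)
          rw [hsucc, hsucc]; ring
      _ = ENNReal.ofReal (4 * 2 ^ j) * ∫⁻ x in R (j + 1), ‖V x‖ₑ :=
          lintegral_const_mul' _ _ ENNReal.ofReal_ne_top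
      _ ≤ ENNReal.ofReal (4 * 2 ^ j) * ∫⁻ x in {x | (2 : ℝ) ^ (j + 1) ≤ φ x ^ 2}, ‖V x‖ₑ := by
          gcongr
          exact fun x hx => hx.1
      _ ≤ ENNReal.ofReal (4 * 2 ^ j) *
            (C * volume {x | (2 : ℝ) ^ (j + 1) ≤ φ x ^ 2} ^ (1 - 2 / (N : ℝ))) := by
          gcongr
          exact hC _ hm
      _ = 4 * C * (ENNReal.ofReal (2 ^ j) *
            volume {x | (2 : ℝ) ^ (j + 1) ≤ φ x ^ 2} ^ (1 - 2 / (N : ℝ))) := by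
          rw [ENNReal.ofReal_mul (by norm_num), ENNReal.ofReal_ofNat]; ring
      _ ≤ 4 * C * (S * ((8 * L ^ 2).toNNReal * ∫⁻ x in R j, ‖∇ φ x‖ₑ ^ 2)) := by
          exact mul_le_mul_right (hlevel j) _
      _ = _ := by push_cast; ring
  have hcover : ∫⁻ x, ‖V x‖ₑ * ‖φ x‖ₑ ^ 2 = ∫⁻ x in ⋃ j, R j, ‖V x‖ₑ * ‖φ x‖ₑ ^ 2 := by
    rw [← lintegral_indicator (MeasurableSet.iUnion hRm)]
    refine lintegral_congr fun x => ?_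
    by_cases hx : x ∈ ⋃ j, R j
    · rw [indicator_of_mem hx]
    · rw [indicator_of_notMem hx]
      have : φ x = 0 := by
        by_contra h0
        obtain ⟨j, hj⟩ := exists_mem_Ico_zpow (x := φ x ^ 2) (y := (2 : ℝ)) (by positivity)
          (by norm_num)
        exact hx (mem_iUnion.2 ⟨j, hj⟩)
      simp [this]
  rw [hcover, lintegral_iUnion hRm hRd, ← (Equiv.addRight (1 : ℤ)).tsum_eq]
  refine (ENNReal.tsum_le_tsum fun j => hring j).trans ?_
  rw [ENNReal.tsum_mul_left, ← lintegral_iUnion hRm hRd]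
  gcongr
  exact setLIntegral_le_lintegral _ _

/-! ### Minimization in a Hilbert space -/

/-- The abstract form of the existence of a minimizer: `B₁ - B₀` is weakly sequentially continuous,
and the best constant `Λ₁` for `B₁` lies strictly below a constant `Λ₀` for `B₀`. Along a weakly
convergent minimizing sequence, `‖x‖² - Λ₁ B₀ x x` is weakly lower semicontinuous since it is a
nonnegative quadratic form; the weak limit cannot vanish because `Λ₁ < Λ₀`. -/
theorem exists_minimizer_of_lt {H : Type*} [NormedAddCommGroup H] [InnerProductSpace ℝ H]
    [CompleteSpace H] [TopologicalSpace.SeparableSpace H] (B₀ B₁ : H →L[ℝ] H →L[ℝ] ℝ)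
    (hsymm : ∀ x y, B₀ x y = B₀ y x) {Λ₀ Λ₁ : ℝ} (hΛ₁ : 0 < Λ₁) (hlt : Λ₁ < Λ₀)
    (h₀ : ∀ x, Λ₀ * B₀ x x ≤ ‖x‖ ^ 2) (h₁ : ∀ x, Λ₁ * B₁ x x ≤ ‖x‖ ^ 2)
    (hweak : ∀ (x : ℕ → H) (y : H), (∀ z, Tendsto (fun k => ⟪x k, z⟫_ℝ) atTop (𝓝 ⟪y, z⟫_ℝ)) →
      Tendsto (fun k => B₁ (x k) (x k) - B₀ (x k) (x k)) atTop (𝓝 (B₁ y y - B₀ y y)))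
    {x : ℕ → H} (hx : ∀ k, B₁ (x k) (x k) = 1)
    (hlim : Tendsto (fun k => ‖x k‖ ^ 2) atTop (𝓝 Λ₁)) :
    ∃ y, B₁ y y = 1 ∧ ‖y‖ ^ 2 = Λ₁ := by
  obtain ⟨R, hR⟩ : ∃ R, ∀ k, ‖x k‖ ^ 2 ≤ R := by
    obtain ⟨R, hR⟩ := hlim.bddAbove_range
    exact ⟨R, fun k => hR ⟨k, rfl⟩⟩
  have hR' : ∀ k, ‖x k‖ ≤ √R := fun k => Real.le_sqrt_of_sq_le (hR k)
  obtain ⟨f, -, ns, hns, hf⟩ := WeakDual.isSeqCompact_closedBall ℝ H (0 : StrongDual ℝ H) (√R)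
    (x := fun k => StrongDual.toWeakDual (InnerProductSpace.toDual ℝ H (x k))) (fun k => by
      simpa using hR' k)
  set y : H := (InnerProductSpace.toDual ℝ H).symm (WeakDual.toStrongDual f) with hy
  have hyw : ∀ z, Tendsto (fun k => ⟪x (ns k), z⟫_ℝ) atTop (𝓝 ⟪y, z⟫_ℝ) := fun z => by
    have h1 : Tendsto (fun k => (InnerProductSpace.toDual ℝ H (x (ns k))) z) atTop (𝓝 (f z)) :=
      ((WeakDual.eval_continuous z).tendsto f).comp hf
    have h2 : ⟪y, z⟫_ℝ = f z := by
      rw [hy, InnerProductSpace.toDual_symm_apply]; rfl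
    simpa only [h2, InnerProductSpace.toDual_apply_apply] using h1
  have hw := hweak _ y hyw
  have hl := hlim.comp hns.tendsto_atTop
  simp only [hx] at hw
  have hb : Tendsto (fun k => B₀ (x (ns k)) y) atTop (𝓝 (B₀ y y)) := by
    have h1 := hyw ((InnerProductSpace.toDual ℝ H).symm (B₀ y))
    simp_rw [real_inner_comm ((InnerProductSpace.toDual ℝ H).symm (B₀ y)),
      InnerProductSpace.toDual_symm_apply] at h1
    simpa only [hsymm y] using h1
  -- expanding this nonnegative form at `x k - y` gives its weak lower semicontinuity
  have hP : ∀ z, 0 ≤ ‖z‖ ^ 2 - Λ₁ * B₀ z z := fun z => by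
    rcases le_total 0 (B₀ z z) with h | h
    · nlinarith [h₀ z, mul_le_mul_of_nonneg_right hlt.le h]
    · nlinarith [sq_nonneg ‖z‖, mul_nonneg hΛ₁.le (neg_nonneg.2 h)]
  have hle : ∀ k, 2 * ⟪x (ns k), y⟫_ℝ - 2 * Λ₁ * B₀ (x (ns k)) y - (‖y‖ ^ 2 - Λ₁ * B₀ y y) ≤
      ‖x (ns k)‖ ^ 2 - Λ₁ * (1 - (1 - B₀ (x (ns k)) (x (ns k)))) := fun k => by
    have := hP (x (ns k) - y)
    rw [norm_sub_sq_real] at this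
    simp only [map_sub, sub_apply] at this
    rw [hsymm y (x (ns k))] at this
    linarith
  have hfin := le_of_tendsto_of_tendsto'
    (((hyw y).const_mul 2).sub (hb.const_mul (2 * Λ₁)) |>.sub_const (‖y‖ ^ 2 - Λ₁ * B₀ y y))
    (hl.sub ((hw.const_sub 1).const_mul Λ₁)) hle
  rw [real_inner_self_eq_norm_sq] at hfin
  have heq : ‖y‖ ^ 2 = Λ₁ * B₁ y y := by linarith [h₁ y]
  -- if `y = 0`, then `B₀ (x k) (x k) → 1`, and `h₀` in the limit gives `Λ₀ ≤ Λ₁`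
  have ht : 0 < B₁ y y := by
    by_contra hcon
    have h0 : ‖y‖ ^ 2 = 0 := by nlinarith [sq_nonneg ‖y‖]
    have hy0 : y = 0 := by simpa using h0
    rw [hy0] at hw
    simp only [map_zero, sub_zero] at hw
    have : Λ₀ * (1 - 0) ≤ Λ₁ := le_of_tendsto_of_tendsto' ((hw.const_sub 1).const_mul Λ₀) hl
      fun k => by simpa using h₀ (x (ns k))
    linarith
  refine ⟨(√(B₁ y y))⁻¹ • y, ?_, ?_⟩
  · simp only [map_smul, smul_apply, smul_eq_mul]
    rw [← mul_assoc, ← mul_inv, Real.mul_self_sqrt ht.le, inv_mul_cancel₀ ht.ne']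
  · rw [norm_smul, mul_pow, heq, norm_inv, inv_pow, Real.norm_of_nonneg (Real.sqrt_nonneg _),
      Real.sq_sqrt ht.le]
    field_simp

/-! ### The space `D^{1,2}` -/

lemma IsTest.memD12 {φ : RN N → ℝ} (hφ : IsTest univ φ) : MemD12 φ (∇ φ) :=
  ⟨hφ.memLp _, hφ.memLp_gradient _, fun _ => φ, fun _ => hφ, by simp, by simp⟩

lemma MemD12.congr_ae {u u' : RN N → ℝ} {G G' : RN N → RN N} (h : MemD12 u G) (hu : u =ᵐ[volume] u')
    (hG : G =ᵐ[volume] G') : MemD12 u' G' := by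
  obtain ⟨φ, hφ, h1, h2⟩ := h.approx
  refine ⟨h.memLp.ae_eq hu, h.memLp_grad.ae_eq hG, φ, hφ, ?_, ?_⟩
  · refine h1.congr fun k => eLpNorm_congr_ae ?_
    filter_upwards [hu] with x hx using by rw [hx]
  · refine h2.congr fun k => eLpNorm_congr_ae ?_
    filter_upwards [hG] with x hx using by rw [hx]

lemma MemD12.add (hN : 3 ≤ N) {u u' : RN N → ℝ} {G G' : RN N → RN N} (h : MemD12 u G)
    (h' : MemD12 u' G') : MemD12 (fun x => u x + u' x) (fun x => G x + G' x) := by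
  obtain ⟨φ, hφ, h1, h2⟩ := h.approx
  obtain ⟨ψ, hψ, h1', h2'⟩ := h'.approx
  refine ⟨h.memLp.add h'.memLp, h.memLp_grad.add h'.memLp_grad, fun k x => φ k x + ψ k x,
    fun k => (hφ k).add (hψ k), ?_, ?_⟩
  · refine tendsto_of_tendsto_of_tendsto_of_le_of_le tendsto_const_nhds
      (by simpa using h1.add h1') (fun _ => zero_le) fun k => ?_
    dsimp only
    simp_rw [add_sub_add_comm]
    exact eLpNorm_add_le (((hφ k).memLp _).sub h.memLp).1 (((hψ k).memLp _).sub h'.memLp).1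
      (one_le_sobolevExp hN)
  · refine tendsto_of_tendsto_of_tendsto_of_le_of_le tendsto_const_nhds
      (by simpa using h2.add h2') (fun _ => zero_le) fun k => ?_
    dsimp only
    simp_rw [(hφ k).gradient_add (hψ k), add_sub_add_comm]
    exact eLpNorm_add_le (((hφ k).memLp_gradient _).sub h.memLp_grad).1
      (((hψ k).memLp_gradient _).sub h'.memLp_grad).1 (by norm_num)

lemma MemD12.const_smul (c : ℝ) {u : RN N → ℝ} {G : RN N → RN N} (h : MemD12 u G) :
    MemD12 (fun x => c * u x) (fun x => c • G x) := by
  obtain ⟨φ, hφ, h1, h2⟩ := h.approx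
  refine ⟨h.memLp.const_mul c, h.memLp_grad.const_smul c, fun k x => c * φ k x,
    fun k => (hφ k).const_mul c, ?_, ?_⟩
  · have := ENNReal.Tendsto.const_mul (a := ‖c‖ₑ) h1 (Or.inr enorm_ne_top)
    rw [mul_zero] at this
    refine this.congr fun k => ?_
    rw [← eLpNorm_const_smul]
    congr 1; ext x; simp [mul_sub]
  · have := ENNReal.Tendsto.const_mul (a := ‖c‖ₑ) h2 (Or.inr enorm_ne_top)
    rw [mul_zero] at this
    refine this.congr fun k => ?_
    rw [← eLpNorm_const_smul]
    congr 1; ext1 x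
    rw [(hφ k).gradient_const_mul c, ← smul_sub, Pi.smul_apply]

lemma MemD12.sub (hN : 3 ≤ N) {u u' : RN N → ℝ} {G G' : RN N → RN N} (h : MemD12 u G)
    (h' : MemD12 u' G') : MemD12 (fun x => u x - u' x) (fun x => G x - G' x) := by
  simpa [sub_eq_add_neg] using h.add hN (h'.const_smul (-1))

lemma MemD12.eLpNorm_le (hN : 3 ≤ N) {S : NNReal}
    (hS : ∀ φ : RN N → ℝ, IsTest univ φ →
      eLpNorm φ (sobolevExp N) volume ≤ S * eLpNorm (∇ φ) 2 volume)
    {u : RN N → ℝ} {G : RN N → RN N} (h : MemD12 u G) :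
    eLpNorm u (sobolevExp N) volume ≤ S * eLpNorm G 2 volume := by
  obtain ⟨φ, hφ, h1, h2⟩ := h.approx
  have hlim : Tendsto (fun k => eLpNorm (fun x => φ k x - u x) (sobolevExp N) volume +
      S * (eLpNorm (fun x => ∇ (φ k) x - G x) 2 volume + eLpNorm G 2 volume)) atTop
      (𝓝 (0 + S * (0 + eLpNorm G 2 volume))) :=
    h1.add (ENNReal.Tendsto.const_mul (h2.add tendsto_const_nhds) (Or.inr ENNReal.coe_ne_top))
  rw [zero_add, zero_add] at hlim
  refine ge_of_tendsto' hlim fun k => ?_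
  have e1 : u = (fun x => u x - φ k x) + φ k := by ext x; simp
  have e2 : ∇ (φ k) = (fun x => ∇ (φ k) x - G x) + G := by ext1 x; simp
  calc eLpNorm u (sobolevExp N) volume
      = eLpNorm ((fun x => u x - φ k x) + φ k) (sobolevExp N) volume := by rw [← e1]
    _ ≤ eLpNorm (fun x => u x - φ k x) (sobolevExp N) volume +
          eLpNorm (φ k) (sobolevExp N) volume :=
        eLpNorm_add_le (h.memLp.sub ((hφ k).memLp _)).1
          (hφ k).continuous.aestronglyMeasurable (one_le_sobolevExp hN)
    _ ≤ eLpNorm (fun x => φ k x - u x) (sobolevExp N) volume + S * eLpNorm (∇ (φ k)) 2 volume := by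
        gcongr
        · exact (eLpNorm_congr_norm_ae (.of_forall fun x => norm_sub_rev _ _)).le
        · exact hS _ (hφ k)
    _ ≤ _ := by
        gcongr
        conv_lhs => rw [e2]
        exact eLpNorm_add_le (((hφ k).memLp_gradient _).sub h.memLp_grad).1 h.memLp_grad.1
          (by norm_num)

/-- The gradient determines the function. -/
lemma MemD12.ae_eq (hN : 3 ≤ N) {u u' : RN N → ℝ} {G G' : RN N → RN N} (h : MemD12 u G)
    (h' : MemD12 u' G') (hG : G =ᵐ[volume] G') : u =ᵐ[volume] u' := by
  obtain ⟨S, hS⟩ := exists_sobolev_const hN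
  have h1 := (h.sub hN h').eLpNorm_le hN hS
  have h2 : eLpNorm (fun x => G x - G' x) 2 volume = 0 := by
    rw [eLpNorm_congr_ae (g := 0), eLpNorm_zero]
    filter_upwards [hG] with x hx using by simp [hx]
  rw [h2, mul_zero, nonpos_iff_eq_zero, eLpNorm_eq_zero_iff (h.sub hN h').memLp.1
    (zero_lt_one.trans_le (one_le_sobolevExp hN)).ne'] at h1
  filter_upwards [h1] with x hx using sub_eq_zero.1 hx

/-- `V` is form-bounded on `D^{1,2}`: `∫ |V| u² ≤ K ∫ |∇u|²`. -/
structure FormBounded (K : NNReal) (V : RN N → ℝ) : Prop where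
  aestronglyMeasurable : AEStronglyMeasurable V volume
  bound : ∀ (u : RN N → ℝ) (G : RN N → RN N), MemD12 u G →
    ∫⁻ x, ‖V x‖ₑ * ‖u x‖ₑ ^ 2 ≤ K * energy G

lemma MemLorentz.exists_formBounded (hN : 3 ≤ N) {V : RN N → ℝ} (hV : MemLorentz ((N : ℝ) / 2) V) :
    ∃ K, FormBounded K V := by
  have h3 : (3 : ℝ) ≤ N := by exact_mod_cast hN
  obtain ⟨C, hC⟩ := hV.exists_lintegral_le (by linarith)
  simp only [one_div_div] at hC
  obtain ⟨K, hK⟩ := exists_hardy_test hN hC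
  refine ⟨K, hV.aestronglyMeasurable, fun u G h => ?_⟩
  obtain ⟨φ, hφ, h1, h2⟩ := h.approx
  obtain ⟨ns, hns, hae⟩ := (tendstoInMeasure_of_tendsto_eLpNorm
    (zero_lt_one.trans_le (one_le_sobolevExp hN)).ne' (fun k => (hφ k).continuous.aestronglyMeasurable)
    h.memLp.1 h1).exists_seq_tendsto_ae
  have hlim : Tendsto (fun k => K *
      (eLpNorm (fun x => ∇ (φ (ns k)) x - G x) 2 volume + eLpNorm G 2 volume) ^ 2) atTop
      (𝓝 (K * (0 + eLpNorm G 2 volume) ^ 2)) :=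
    ENNReal.Tendsto.const_mul (((ENNReal.continuous_pow 2).tendsto _).comp
      ((h2.comp hns.tendsto_atTop).add tendsto_const_nhds)) (Or.inr ENNReal.coe_ne_top)
  rw [zero_add, eLpNorm_two_sq] at hlim
  calc ∫⁻ x, ‖V x‖ₑ * ‖u x‖ₑ ^ 2
      = ∫⁻ x, liminf (fun k => ‖V x‖ₑ * ‖φ (ns k) x‖ₑ ^ 2) atTop := by
        refine lintegral_congr_ae ?_
        filter_upwards [hae] with x hx
        refine (Tendsto.liminf_eq ?_).symm
        exact ENNReal.Tendsto.const_mul (((ENNReal.continuous_pow 2).tendsto _).comp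
          ((continuous_enorm.tendsto _).comp hx)) (Or.inr enorm_ne_top)
    _ ≤ liminf (fun k => ∫⁻ x, ‖V x‖ₑ * ‖φ (ns k) x‖ₑ ^ 2) atTop :=
        lintegral_liminf_le' fun k =>
          hV.aestronglyMeasurable.enorm.mul (((hφ (ns k)).continuous.aestronglyMeasurable.enorm).pow_const 2)
    _ ≤ liminf (fun k => K *
          (eLpNorm (fun x => ∇ (φ (ns k)) x - G x) 2 volume + eLpNorm G 2 volume) ^ 2) atTop := by
        refine liminf_le_liminf (.of_forall fun k => (hK _ (hφ (ns k))).trans ?_)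
        rw [← eLpNorm_two_sq]
        gcongr
        have e2 : ∇ (φ (ns k)) = (fun x => ∇ (φ (ns k)) x - G x) + G := by ext1 x; simp
        conv_lhs => rw [e2]
        exact eLpNorm_add_le (((hφ (ns k)).memLp_gradient _).sub h.memLp_grad).1 h.memLp_grad.1
          (by norm_num)
    _ = K * energy G := hlim.liminf_eq

lemma energy_lt_top {G : RN N → RN N} (h : MemLp G 2 volume) : energy G < ⊤ := by
  rw [← eLpNorm_two_sq]; exact ENNReal.pow_lt_top h.2

lemma integral_norm_sq {G : RN N → RN N} (h : MemLp G 2 volume) :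
    ∫ x, ‖G x‖ ^ 2 = (energy G).toReal := by
  rw [integral_eq_lintegral_of_nonneg_ae (.of_forall fun x => by positivity)
    (show AEStronglyMeasurable (fun x => ‖G x‖ ^ 2) volume from h.1.norm.pow 2), energy]
  congr 1
  refine lintegral_congr fun x => ?_
  rw [ENNReal.ofReal_pow (norm_nonneg _), ofReal_norm]

namespace FormBounded

variable {K : NNReal} {V : RN N → ℝ} {u w : RN N → ℝ} {G H : RN N → RN N}

lemma integrable_sq (hV : FormBounded K V) (h : MemD12 u G) :
    Integrable (fun x => V x * u x ^ 2) := by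
  refine ⟨hV.aestronglyMeasurable.mul (h.memLp.1.pow 2), ?_⟩
  rw [HasFiniteIntegral]
  simp only [enorm_mul, enorm_pow]
  exact (hV.bound u G h).trans_lt (ENNReal.mul_lt_top ENNReal.coe_lt_top (energy_lt_top h.memLp_grad))

lemma integral_abs_le (hV : FormBounded K V) (h : MemD12 u G) :
    ∫ x, |V x| * u x ^ 2 ≤ K * ∫ x, ‖G x‖ ^ 2 := by
  rw [integral_norm_sq h.memLp_grad, integral_eq_lintegral_of_nonneg_ae
    (.of_forall fun x => by positivity)
    (show AEStronglyMeasurable (fun x => |V x| * u x ^ 2) volume from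
      hV.aestronglyMeasurable.norm.mul (h.memLp.1.pow 2)), ← ENNReal.coe_toReal, ← ENNReal.toReal_mul]
  refine ENNReal.toReal_mono
    (ENNReal.mul_lt_top ENNReal.coe_lt_top (energy_lt_top h.memLp_grad)).ne
    (le_of_eq_of_le (lintegral_congr fun x => ?_) (hV.bound u G h))
  rw [ENNReal.ofReal_mul (abs_nonneg _), ← Real.enorm_eq_ofReal_abs, ← sq_abs,
    ENNReal.ofReal_pow (abs_nonneg _), ← Real.enorm_eq_ofReal_abs]

lemma abs_integrand_le (V : RN N → ℝ) (u w : RN N → ℝ) (x : RN N) :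
    ‖V x * u x * w x‖ ≤ |V x| * u x ^ 2 + |V x| * w x ^ 2 := by
  rw [Real.norm_eq_abs, abs_mul, abs_mul, mul_assoc, ← mul_add]
  gcongr
  nlinarith [sq_nonneg (|u x| - |w x|), sq_abs (u x), sq_abs (w x), sq_nonneg (u x), sq_nonneg (w x)]

lemma integrable_abs_sq (hV : FormBounded K V) (h : MemD12 u G) :
    Integrable (fun x => |V x| * u x ^ 2) := by
  refine (hV.integrable_sq h).norm.congr (.of_forall fun x => ?_)
  simp

lemma integrable_mul (hV : FormBounded K V) (h : MemD12 u G) (h' : MemD12 w H) :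
    Integrable (fun x => V x * u x * w x) :=
  ((hV.integrable_abs_sq h).add (hV.integrable_abs_sq h')).mono'
    ((hV.aestronglyMeasurable.mul h.memLp.1).mul h'.memLp.1)
    (.of_forall fun x => abs_integrand_le V u w x)

lemma abs_integral_mul_le (hV : FormBounded K V) (h : MemD12 u G) (h' : MemD12 w H) :
    |∫ x, V x * u x * w x| ≤ K * (∫ x, ‖G x‖ ^ 2) + K * ∫ x, ‖H x‖ ^ 2 := by
  calc |∫ x, V x * u x * w x| ≤ ∫ x, (|V x| * u x ^ 2 + |V x| * w x ^ 2) :=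
        norm_integral_le_of_norm_le ((hV.integrable_abs_sq h).add (hV.integrable_abs_sq h'))
          (.of_forall fun x => abs_integrand_le V u w x)
    _ = (∫ x, |V x| * u x ^ 2) + ∫ x, |V x| * w x ^ 2 :=
        integral_add (hV.integrable_abs_sq h) (hV.integrable_abs_sq h')
    _ ≤ _ := add_le_add (hV.integral_abs_le h) (hV.integral_abs_le h')

end FormBounded

/-! ### `D^{1,2}` as a Hilbert space of gradients -/

/-- The gradients of test functions, as a subspace of `L²(ℝ^N; ℝ^N)`. -/
def testGrad (N : ℕ) : Submodule ℝ (Lp (RN N) 2 (volume : Measure (RN N))) where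
  carrier := {g | ∃ φ : RN N → ℝ, IsTest univ φ ∧ g =ᵐ[volume] ∇ φ}
  add_mem' := by
    rintro g h ⟨φ, hφ, hg⟩ ⟨ψ, hψ, hh⟩
    refine ⟨_, hφ.add hψ, ?_⟩
    filter_upwards [Lp.coeFn_add g h, hg, hh] with x h1 h2 h3
    rw [h1, Pi.add_apply, h2, h3, hφ.gradient_add hψ]
  zero_mem' := by
    refine ⟨_, IsTest.zero, ?_⟩
    filter_upwards [Lp.coeFn_zero (RN N) 2 (volume : Measure (RN N))] with x h1
    rw [h1]; simp [gradient]
  smul_mem' := by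
    rintro c g ⟨φ, hφ, hg⟩
    refine ⟨_, hφ.const_mul c, ?_⟩
    filter_upwards [Lp.coeFn_smul c g, hg] with x h1 h2
    rw [h1, Pi.smul_apply, h2, hφ.gradient_const_mul]

/-- The closure in `L²(ℝ^N; ℝ^N)` of the gradients of test functions. It is the Hilbert space
`D^{1,2}(ℝ^N)`, whose elements are represented by their gradients. -/
abbrev gradSpace (N : ℕ) : Submodule ℝ (Lp (RN N) 2 (volume : Measure (RN N))) :=
  (testGrad N).topologicalClosure

instance : CompleteSpace (gradSpace N) :=
  (testGrad N).isClosed_topologicalClosure.completeSpace_coe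

instance : TopologicalSpace.SeparableSpace (gradSpace N) := by
  have : Fact ((2 : ℝ≥0∞) ≠ ⊤) := ⟨by norm_num⟩
  have : SecondCountableTopology (Lp (RN N) 2 (volume : Measure (RN N))) :=
    Lp.SecondCountableTopology
  have : SecondCountableTopology (gradSpace N) :=
    TopologicalSpace.Subtype.secondCountableTopology _
  infer_instance

lemma MemD12.toLp_mem {u : RN N → ℝ} {G : RN N → RN N} (h : MemD12 u G) :
    h.memLp_grad.toLp G ∈ gradSpace N := by
  obtain ⟨φ, hφ, -, h2⟩ := h.approx
  refine mem_closure_of_tendsto ((Lp.tendsto_Lp_iff_tendsto_eLpNorm'' (fun k => ∇ (φ k))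
    (fun k => (hφ k).memLp_gradient 2) G h.memLp_grad).2 h2) (.of_forall fun k => ?_)
  exact ⟨φ k, hφ k, MemLp.coeFn_toLp _⟩

/-- Every element of `gradSpace N` is the gradient of a function in `D^{1,2}`: by the Sobolev
inequality, test functions whose gradients converge in `L²` converge in `L^{2N/(N-2)}`. -/
lemma exists_memD12_of_mem_gradSpace (hN : 3 ≤ N) (g : gradSpace N) :
    ∃ u : RN N → ℝ, MemD12 u (g : Lp (RN N) 2 (volume : Measure (RN N))) := by
  have : Fact (1 ≤ sobolevExp N) := ⟨one_le_sobolevExp hN⟩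
  obtain ⟨S, hS⟩ := exists_sobolev_const hN
  obtain ⟨g, hg⟩ := g
  obtain ⟨gk, hgk, hlim⟩ := mem_closure_iff_seq_limit.1 hg
  choose φ hφ hae using hgk
  have hc := (Lp.cauchySeq_Lp_iff_cauchySeq_eLpNorm gk).1 hlim.cauchySeq
  have hc' : CauchySeq fun k => ((hφ k).memLp (sobolevExp N)).toLp (φ k) := by
    rw [Lp.cauchySeq_Lp_iff_cauchySeq_eLpNorm]
    have hSc := ENNReal.Tendsto.const_mul (a := (S : ℝ≥0∞)) hc (Or.inr ENNReal.coe_ne_top)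
    rw [mul_zero] at hSc
    refine tendsto_of_tendsto_of_tendsto_of_le_of_le tendsto_const_nhds hSc
      (fun _ => zero_le) fun n => ?_
    have hd := (hφ n.1).add ((hφ n.2).const_mul (-1))
    refine (le_of_eq_of_le (eLpNorm_congr_ae ?_) (hS _ hd)).trans_eq ?_
    · filter_upwards [MemLp.coeFn_toLp ((hφ n.1).memLp (sobolevExp N)),
        MemLp.coeFn_toLp ((hφ n.2).memLp (sobolevExp N))] with x h1 h2
      rw [Pi.sub_apply, h1, h2]; ring
    · congr 1
      refine eLpNorm_congr_ae ?_
      filter_upwards [hae n.1, hae n.2] with x h1 h2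
      rw [Pi.sub_apply, h1, h2, (hφ n.1).gradient_add ((hφ n.2).const_mul (-1)),
        (hφ n.2).gradient_const_mul]
      simp [sub_eq_add_neg]
  obtain ⟨u, hu⟩ := cauchySeq_tendsto_of_complete hc'
  refine ⟨u, Lp.memLp u, Lp.memLp g, φ, hφ, ?_, ?_⟩
  · rw [Lp.tendsto_Lp_iff_tendsto_eLpNorm'] at hu
    refine hu.congr fun k => eLpNorm_congr_ae ?_
    filter_upwards [MemLp.coeFn_toLp ((hφ k).memLp (sobolevExp N))] with x h1
    rw [Pi.sub_apply, h1]
  · rw [Lp.tendsto_Lp_iff_tendsto_eLpNorm'] at hlim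
    refine hlim.congr fun k => eLpNorm_congr_ae ?_
    filter_upwards [hae k] with x h1
    rw [Pi.sub_apply, h1]

/-- The function in `D^{1,2}` with a given gradient (unique almost everywhere). -/
def lift (g : gradSpace N) : RN N → ℝ :=
  Classical.epsilon fun u => MemD12 u (g : Lp (RN N) 2 (volume : Measure (RN N)))

lemma memD12_lift (hN : 3 ≤ N) (g : gradSpace N) :
    MemD12 (lift g) (g : Lp (RN N) 2 (volume : Measure (RN N))) :=
  Classical.epsilon_spec (exists_memD12_of_mem_gradSpace hN g)

lemma lift_add (hN : 3 ≤ N) (g h : gradSpace N) :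
    lift (g + h) =ᵐ[volume] fun x => lift g x + lift h x :=
  (memD12_lift hN _).ae_eq hN ((memD12_lift hN g).add hN (memD12_lift hN h)) (Lp.coeFn_add _ _)

lemma lift_smul (hN : 3 ≤ N) (c : ℝ) (g : gradSpace N) :
    lift (c • g) =ᵐ[volume] fun x => c * lift g x :=
  (memD12_lift hN _).ae_eq hN ((memD12_lift hN g).const_smul c) (Lp.coeFn_smul _ _)

lemma norm_sq_eq_integral (g : gradSpace N) :
    ‖g‖ ^ 2 = ∫ x, ‖(g : Lp (RN N) 2 (volume : Measure (RN N))) x‖ ^ 2 := by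
  rw [integral_norm_sq (Lp.memLp _), ← eLpNorm_two_sq, ENNReal.toReal_pow, ← Lp.norm_def]
  rfl

/-- A bilinear form bounded by `K (‖x‖² + ‖y‖²)` is bounded by `2 K ‖x‖ ‖y‖`, by scaling. -/
lemma abs_le_of_abs_le_add_sq {E : Type*} [NormedAddCommGroup E] [NormedSpace ℝ E]
    (B : E →ₗ[ℝ] E →ₗ[ℝ] ℝ) {K : ℝ} (hB : ∀ x y, |B x y| ≤ K * ‖x‖ ^ 2 + K * ‖y‖ ^ 2) (x y : E) :
    |B x y| ≤ 2 * K * ‖x‖ * ‖y‖ := by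
  rcases eq_or_ne x 0 with rfl | hx
  · simp
  rcases eq_or_ne y 0 with rfl | hy
  · simp
  have hx' : 0 < ‖x‖ := norm_pos_iff.2 hx
  have hy' : 0 < ‖y‖ := norm_pos_iff.2 hy
  have h := hB (‖x‖⁻¹ • x) (‖y‖⁻¹ • y)
  simp only [map_smul, LinearMap.smul_apply, smul_eq_mul, abs_mul, abs_inv, abs_norm, norm_smul,
    norm_inv, norm_norm] at h
  rw [inv_mul_cancel₀ hx'.ne', inv_mul_cancel₀ hy'.ne'] at h
  have h2 : |B x y| = ‖x‖ * ‖y‖ * (‖x‖⁻¹ * (‖y‖⁻¹ * |B x y|)) := by field_simp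
  rw [h2]
  nlinarith [mul_le_mul_of_nonneg_left h (mul_pos hx' hy').le]

/-- The bilinear form `∫ V u w` on `D^{1,2}`, for a form-bounded `V`. -/
def formAux (hN : 3 ≤ N) {K : NNReal} {V : RN N → ℝ} (hV : FormBounded K V) :
    gradSpace N →ₗ[ℝ] gradSpace N →ₗ[ℝ] ℝ :=
  LinearMap.mk₂ ℝ (fun g h => ∫ x, V x * lift g x * lift h x)
    (fun g g' h => by
      rw [← integral_add (hV.integrable_mul (memD12_lift hN g) (memD12_lift hN h))
        (hV.integrable_mul (memD12_lift hN g') (memD12_lift hN h))]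
      refine integral_congr_ae ?_
      filter_upwards [lift_add hN g g'] with x hx
      rw [hx]; ring)
    (fun c g h => by
      rw [smul_eq_mul, ← integral_const_mul]
      refine integral_congr_ae ?_
      filter_upwards [lift_smul hN c g] with x hx
      rw [hx]; ring)
    (fun g h h' => by
      rw [← integral_add (hV.integrable_mul (memD12_lift hN g) (memD12_lift hN h))
        (hV.integrable_mul (memD12_lift hN g) (memD12_lift hN h'))]
      refine integral_congr_ae ?_
      filter_upwards [lift_add hN h h'] with x hx
      rw [hx]; ring)
    (fun c g h => by
      rw [smul_eq_mul, ← integral_const_mul]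
      refine integral_congr_ae ?_
      filter_upwards [lift_smul hN c h] with x hx
      rw [hx]; ring)

lemma abs_formAux_le (hN : 3 ≤ N) {K : NNReal} {V : RN N → ℝ} (hV : FormBounded K V)
    (g h : gradSpace N) : |formAux hN hV g h| ≤ K * ‖g‖ ^ 2 + K * ‖h‖ ^ 2 := by
  rw [norm_sq_eq_integral, norm_sq_eq_integral]
  exact hV.abs_integral_mul_le (memD12_lift hN g) (memD12_lift hN h)

/-- The form `formAux` as a bounded bilinear form. -/
def form (hN : 3 ≤ N) {K : NNReal} {V : RN N → ℝ} (hV : FormBounded K V) :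
    gradSpace N →L[ℝ] gradSpace N →L[ℝ] ℝ :=
  (formAux hN hV).mkContinuous₂ (2 * K) (abs_le_of_abs_le_add_sq _ (abs_formAux_le hN hV))

lemma form_apply (hN : 3 ≤ N) {K : NNReal} {V : RN N → ℝ} (hV : FormBounded K V)
    (g h : gradSpace N) : form hN hV g h = ∫ x, V x * lift g x * lift h x := rfl

lemma form_self (hN : 3 ≤ N) {K : NNReal} {V : RN N → ℝ} (hV : FormBounded K V)
    {u : RN N → ℝ} {g : gradSpace N}
    (h : MemD12 u (g : Lp (RN N) 2 (volume : Measure (RN N)))) :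
    form hN hV g g = ∫ x, V x * u x ^ 2 := by
  rw [form_apply]
  refine integral_congr_ae ?_
  filter_upwards [(memD12_lift hN g).ae_eq hN h .rfl] with x hx
  rw [hx]; ring

/-! ### The best constant -/

section Lam

variable {V : RN N → ℝ} {K : NNReal}

lemma lam_le {u : RN N → ℝ} {G : RN N → RN N} (h : MemD12 u G)
    (hu : ∫ x, V x * u x ^ 2 = 1) : Lam V ≤ ∫ x, ‖G x‖ ^ 2 :=
  csInf_le ⟨0, by rintro t ⟨u, G, -, -, rfl⟩; positivity⟩ ⟨u, G, h, hu, rfl⟩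

lemma lam_nonneg (V : RN N → ℝ) : 0 ≤ Lam V :=
  Real.sInf_nonneg (by rintro t ⟨u, G, -, -, rfl⟩; positivity)

lemma MemD12.normalize {u : RN N → ℝ} {G : RN N → RN N} (h : MemD12 u G)
    (hu : 0 < ∫ x, V x * u x ^ 2) :
    ∃ (w : RN N → ℝ) (H : RN N → RN N), MemD12 w H ∧ ∫ x, V x * w x ^ 2 = 1 ∧
      ∫ x, ‖H x‖ ^ 2 = (∫ x, ‖G x‖ ^ 2) / ∫ x, V x * u x ^ 2 := by
  set t := ∫ x, V x * u x ^ 2 with ht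
  have hs : (√t)⁻¹ ^ 2 = t⁻¹ := by rw [inv_pow, Real.sq_sqrt hu.le]
  refine ⟨_, _, h.const_smul (√t)⁻¹, ?_, ?_⟩
  · simp_rw [mul_pow, hs, mul_left_comm _ t⁻¹]
    rw [integral_const_mul, ← ht, inv_mul_cancel₀ hu.ne']
  · simp_rw [norm_smul, mul_pow, Real.norm_eq_abs, sq_abs, hs]
    rw [integral_const_mul, div_eq_inv_mul]

lemma lam_mul_le {u : RN N → ℝ} {G : RN N → RN N} (h : MemD12 u G) :
    Lam V * ∫ x, V x * u x ^ 2 ≤ ∫ x, ‖G x‖ ^ 2 := by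
  rcases lt_or_ge 0 (∫ x, V x * u x ^ 2) with hpos | hneg
  · obtain ⟨w, H, hw, h1, h2⟩ := h.normalize hpos
    rw [← le_div_iff₀ hpos, ← h2]
    exact lam_le hw h1
  · exact (mul_nonpos_of_nonneg_of_nonpos (lam_nonneg V) hneg).trans
      (integral_nonneg fun x => by positivity)

lemma lam_pos (hV : FormBounded K V)
    (hφ : ∃ φ : RN N → ℝ, IsTest univ φ ∧ 0 < ∫ x, V x * φ x ^ 2) : 0 < Lam V := by
  obtain ⟨φ, hφ, hpos⟩ := hφ
  obtain ⟨w, H, hw, h1, -⟩ := hφ.memD12.normalize hpos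
  refine lt_of_lt_of_le (b := ((K : ℝ) + 1)⁻¹) (by positivity)
    (le_csInf ⟨_, w, H, hw, h1, rfl⟩ ?_)
  rintro t ⟨u, G, hu, hu1, rfl⟩
  have h2 : (1 : ℝ) ≤ K * ∫ x, ‖G x‖ ^ 2 := by
    rw [← hu1]
    refine (integral_mono (hV.integrable_sq hu) (hV.integrable_abs_sq hu) fun x => ?_).trans
      (hV.integral_abs_le hu)
    exact mul_le_mul_of_nonneg_right (le_abs_self _) (sq_nonneg _)
  have h3 : 0 ≤ ∫ x, ‖G x‖ ^ 2 := integral_nonneg fun x => by positivity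
  rw [inv_le_iff_one_le_mul₀ (by positivity)]
  nlinarith

end Lam

/-- If `V₁ - V₀` is weakly continuous and the best constant for `V₁` is positive and strictly
below that for `V₀`, then it is attained. -/
theorem exists_isMinimizer_of_lam_lt (hN : 3 ≤ N) {V₀ V₁ : RN N → ℝ} {K₀ K₁ : NNReal}
    (h₀ : FormBounded K₀ V₀) (h₁ : FormBounded K₁ V₁)
    (hweak : WeaklyContinuousD12 (fun x => V₁ x - V₀ x))
    (hφ : ∃ φ : RN N → ℝ, IsTest univ φ ∧ 0 < ∫ x, V₁ x * φ x ^ 2) (hlt : Lam V₁ < Lam V₀) :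
    ∃ u, IsMinimizer V₁ u := by
  have hpos := lam_pos h₁ hφ
  obtain ⟨φ, hφ, hφ1⟩ := hφ
  obtain ⟨w, H, hw, hw1, -⟩ := hφ.memD12.normalize hφ1
  obtain ⟨t, -, ht, hmem⟩ := exists_seq_tendsto_sInf (S := {t : ℝ | ∃ (u : RN N → ℝ)
    (G : RN N → RN N), MemD12 u G ∧ ∫ x, V₁ x * u x ^ 2 = 1 ∧ t = ∫ x, ‖G x‖ ^ 2})
    ⟨_, w, H, hw, hw1, rfl⟩ ⟨0, by rintro t ⟨u, G, -, -, rfl⟩; positivity⟩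
  choose u G hu hu1 htG using hmem
  set g : ℕ → gradSpace N := fun k => ⟨(hu k).memLp_grad.toLp (G k), (hu k).toLp_mem⟩ with hg
  have hgu : ∀ k, MemD12 (u k) (g k : Lp (RN N) 2 (volume : Measure (RN N))) := fun k =>
    (hu k).congr_ae .rfl (MemLp.coeFn_toLp (hu k).memLp_grad).symm
  have hbound : ∀ {V : RN N → ℝ} {K : NNReal} (hV : FormBounded K V) (x : gradSpace N),
      Lam V * form hN hV x x ≤ ‖x‖ ^ 2 := fun hV x => by
    rw [form_self hN hV (memD12_lift hN x), norm_sq_eq_integral]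
    exact lam_mul_le (memD12_lift hN x)
  have hdiff : ∀ x : gradSpace N, form hN h₁ x x - form hN h₀ x x =
      ∫ y, (V₁ y - V₀ y) * lift x y ^ 2 := fun x => by
    rw [form_self hN h₁ (memD12_lift hN x), form_self hN h₀ (memD12_lift hN x),
      ← integral_sub (h₁.integrable_sq (memD12_lift hN x)) (h₀.integrable_sq (memD12_lift hN x))]
    simp_rw [sub_mul]
  obtain ⟨y, hy1, hy2⟩ := exists_minimizer_of_lt (form hN h₀) (form hN h₁)
    (fun x y => by
      rw [form_apply, form_apply]
      exact integral_congr_ae (.of_forall fun z => by ring))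
    hpos hlt (hbound h₀) (hbound h₁)
    (fun x y hxy => by
      simp_rw [hdiff]
      refine hweak _ _ _ _ (fun k => memD12_lift hN (x k)) (memD12_lift hN y) fun w H hw => ?_
      have h := hxy ⟨hw.memLp_grad.toLp H, hw.toLp_mem⟩
      have e : ∀ z : gradSpace N, ⟪z, ⟨hw.memLp_grad.toLp H, hw.toLp_mem⟩⟫_ℝ =
          ∫ v, ⟪(z : Lp (RN N) 2 (volume : Measure (RN N))) v, H v⟫_ℝ := fun z => by
        rw [Submodule.coe_inner, L2.inner_def]
        refine integral_congr_ae ?_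
        filter_upwards [MemLp.coeFn_toLp hw.memLp_grad] with v hv
        rw [hv]
      simpa only [e] using h)
    (x := g) (fun k => by rw [form_self hN h₁ (hgu k), hu1])
    (ht.congr fun k => by
      rw [htG, norm_sq_eq_integral]
      refine integral_congr_ae ?_
      filter_upwards [MemLp.coeFn_toLp (hu k).memLp_grad] with x hx
      rw [hx])
  exact ⟨lift y, _, memD12_lift hN y, by rw [← form_self hN h₁ (memD12_lift hN y), hy1],
    by rw [← norm_sq_eq_integral, hy2]⟩

/-! ### Cutoff functions and sets of positive measure -/

/-- Smooth cutoffs of a compact set, supported in an arbitrarily small neighbourhood of it. -/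
lemma exists_cutoff {K : Set (RN N)} (hK : IsCompact K) {ε : ℝ} (hε : 0 < ε) :
    ∃ φ : RN N → ℝ, IsTest univ φ ∧ (∀ x, 0 ≤ φ x ∧ φ x ≤ 1) ∧ (∀ x ∈ K, φ x = 1) ∧
      ∀ x ∉ Metric.thickening ε K, φ x = 0 := by
  obtain ⟨φ, hφ, hr, hs, h1⟩ := exists_contMDiff_support_eq_eq_one_iff
    (modelWithCornersSelf ℝ (RN N)) (n := ⊤) (Metric.isOpen_thickening (δ := ε) (E := K))
    hK.isClosed (Metric.self_subset_thickening hε K)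
  refine ⟨φ, ⟨hφ.contDiff, ?_, subset_univ _⟩, fun x => hr (mem_range_self x),
    fun x hx => (h1 x).1 hx, fun x hx => ?_⟩
  · exact HasCompactSupport.of_support_subset_isCompact hK.cthickening
      (hs.trans_subset (Metric.thickening_subset_cthickening _ _))
  · rw [← Function.notMem_support, hs]; exact hx

lemma exists_isCompact_subset_measure_pos {A : Set (RN N)} (hA : NullMeasurableSet A volume)
    (hpos : 0 < volume A) : ∃ K ⊆ A, IsCompact K ∧ 0 < volume K := by
  obtain ⟨B, hBA, hB, hae⟩ := hA.exists_measurable_subset_ae_eq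
  rw [← measure_congr hae] at hpos
  obtain ⟨K, hK, hKc, h⟩ := hB.exists_lt_isCompact hpos
  exact ⟨K, hK.trans hBA, hKc, h⟩

lemma integrable_mul_test_sq {V : RN N → ℝ} (hV : LocallyIntegrable V volume) {φ : RN N → ℝ}
    (hφ : IsTest univ φ) : Integrable (fun x => V x * φ x ^ 2) := by
  have := hV.integrable_smul_left_of_hasCompactSupport (g := fun x => φ x ^ 2)
    (hφ.continuous.pow 2) (hφ.compact.comp_left (g := fun t : ℝ => t ^ 2) (by simp))
  refine this.congr (.of_forall fun x => ?_)
  simp [mul_comm]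

/-- A function that is positive on a set of positive measure has a positive integral against the
square of some test function, namely a cutoff of a compact set on which it is positive. -/
lemma exists_test_integral_pos {V : RN N → ℝ} (hV : LocallyIntegrable V volume)
    (hpos : 0 < volume {x | 0 < V x}) :
    ∃ φ : RN N → ℝ, IsTest univ φ ∧ 0 < ∫ x, V x * φ x ^ 2 := by
  obtain ⟨K, hKV, hK, hKpos⟩ := exists_isCompact_subset_measure_pos
    (nullMeasurableSet_lt aemeasurable_const hV.aestronglyMeasurable.aemeasurable) hpos
  have hint : 0 < ∫ x in K, V x := by
    rw [setIntegral_pos_iff_support_of_nonneg_ae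
      ((ae_restrict_iff' hK.measurableSet).2 (.of_forall fun x hx => (hKV hx).le))
      (hV.integrableOn_isCompact hK)]
    have hsub : K ⊆ Function.support V := fun x hx => ne_of_gt (show 0 < V x from hKV hx)
    rwa [inter_eq_right.2 hsub]
  choose φ hφ h01 h1 h0 using fun n : ℕ => exists_cutoff hK (Nat.one_div_pos_of_nat (α := ℝ) (n := n))
  set B := Metric.cthickening 1 K with hB
  have hBc : IsCompact B := hK.cthickening
  have hle : ∀ n : ℕ, (1 : ℝ) / (n + 1) ≤ 1 := fun n => by
    rw [div_le_one (by positivity)]; linarith [n.cast_nonneg (α := ℝ)]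
  have hlim : Tendsto (fun n => ∫ x, V x * φ n x ^ 2) atTop (𝓝 (∫ x in K, V x)) := by
    rw [← integral_indicator hK.measurableSet]
    refine tendsto_integral_of_dominated_convergence (B.indicator fun x => ‖V x‖)
      (fun n => (integrable_mul_test_sq hV (hφ n)).1)
      ((integrable_indicator_iff hBc.measurableSet).2 (hV.integrableOn_isCompact hBc).norm)
      (fun n => .of_forall fun x => ?_) (.of_forall fun x => ?_)
    · by_cases hx : x ∈ B
      · rw [indicator_of_mem hx, norm_mul, Real.norm_of_nonneg (sq_nonneg (φ n x))]
        exact mul_le_of_le_one_right (norm_nonneg _) (pow_le_one₀ (h01 n x).1 (h01 n x).2)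
      · rw [indicator_of_notMem hx, h0 n x]
        · simp
        · exact fun h => hx (Metric.thickening_subset_cthickening_of_le (hle n) K h)
    · by_cases hx : x ∈ K
      · simp [indicator_of_mem hx, h1 _ x hx]
      · rw [indicator_of_notMem hx]
        refine tendsto_const_nhds.congr' ?_
        obtain ⟨ε, εpos, hε⟩ : ∃ ε : ℝ, 0 < ε ∧ x ∉ Metric.thickening ε K := by
          rw [← hK.isClosed.closure_eq, Metric.closure_eq_iInter_thickening K] at hx
          simpa using hx
        filter_upwards [(tendsto_one_div_add_atTop_nhds_zero_nat (𝕜 := ℝ)).eventually_lt_const εpos]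
          with n hn
        rw [h0 n x (fun h => hε (Metric.thickening_mono hn.le K h))]
        simp
  obtain ⟨n, hn⟩ := (hlim.eventually_const_lt hint).exists
  exact ⟨φ n, hφ n, hn⟩

/-- By the Sobolev inequality, closed sets of capacity zero are Lebesgue null sets. -/
lemma IsClosedCapZero.measure_eq_zero (hN : 3 ≤ N) {Z : Set (RN N)} (hZ : IsClosedCapZero Z) :
    volume Z = 0 := by
  have h3 : (3 : ℝ) ≤ N := by exact_mod_cast hN
  have hp : (0 : ℝ) < 1 - 2 / (N : ℝ) := by
    rw [sub_pos, div_lt_one (by linarith)]; linarith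
  obtain ⟨S, hS⟩ := exists_measure_rpow_le_energy hN
  by_contra hne
  obtain ⟨K, hKZ, hK, hKpos⟩ := exists_isCompact_subset_measure_pos
    hZ.1.measurableSet.nullMeasurableSet (pos_iff_ne_zero.2 hne)
  have hcap := hZ.2 K hK hKZ
  have hbound : ∀ ε : ℝ, 0 < ε → volume K ^ (1 - 2 / (N : ℝ)) ≤ S * ENNReal.ofReal ε := by
    intro ε hε
    obtain ⟨φ, hφ, -, hφ1, -⟩ := exists_cutoff hK one_pos
    obtain ⟨t, ⟨u, hu, hu1, rfl⟩, ht⟩ := exists_lt_of_csInf_lt (s := {t : ℝ | ∃ u : RN N → ℝ,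
      IsTest univ u ∧ (∀ x ∈ K, 1 ≤ u x) ∧ t = ∫ x, ‖∇ u x‖ ^ 2})
      ⟨_, φ, hφ, fun x hx => (hφ1 x hx).ge, rfl⟩ (hcap.trans_lt hε)
    refine (hS u K hu hu1).trans ?_
    gcongr
    rw [integral_norm_sq (hu.memLp_gradient 2)] at ht
    rw [← ENNReal.ofReal_toReal (energy_lt_top (hu.memLp_gradient 2)).ne]
    exact ENNReal.ofReal_le_ofReal ht.le
  have hlim : Tendsto (fun ε : ℝ => S * ENNReal.ofReal ε) (𝓝[>] 0) (𝓝 0) := by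
    have : Tendsto (fun ε : ℝ => S * ENNReal.ofReal ε) (𝓝 0) (𝓝 (S * ENNReal.ofReal 0)) :=
      ENNReal.Tendsto.const_mul (ENNReal.continuous_ofReal.tendsto 0) (Or.inr ENNReal.coe_ne_top)
    rw [ENNReal.ofReal_zero, mul_zero] at this
    exact this.mono_left nhdsWithin_le_nhds
  have h0 := ge_of_tendsto hlim (eventually_mem_nhdsWithin.mono fun ε hε => hbound ε hε)
  rw [nonpos_iff_eq_zero, ENNReal.rpow_eq_zero_iff_of_pos hp] at h0
  exact hKpos.ne' h0

/-! ### Null sequences -/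

lemma Q_eq {V : RN N → ℝ} (hV : LocallyIntegrable V volume) {φ : RN N → ℝ} (hφ : IsTest univ φ) :
    Q V φ = (∫ x, ‖∇ φ x‖ ^ 2) - Lam V * ∫ x, V x * φ x ^ 2 := by
  simp_rw [Q, mul_assoc]
  rw [integral_sub ((hφ.memLp_gradient 2).integrable_norm_pow (by norm_num))
    ((integrable_mul_test_sq hV hφ).const_mul _), integral_const_mul]

/-- Some member of a null sequence with `limsup ∫ (V₁ - V₀) v_k² > 0` has a smaller quotient for
`V₁` than `Λ₀`. -/
lemma lam_lt_of_isNullSeq {V₀ V₁ : RN N → ℝ} (hV₀ : LocallyIntegrable V₀ volume)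
    (hV₁ : LocallyIntegrable V₁ volume) (hpos : 0 < Lam V₀) {vk : ℕ → RN N → ℝ}
    (hv : IsNullSeq V₀ vk) (hlim : 0 < limsupInt (fun x => V₁ x - V₀ x) vk) :
    Lam V₁ < Lam V₀ := by
  obtain ⟨ε, hε0, hε⟩ := EReal.lt_iff_exists_real_btwn.1 hlim
  have hε0 : 0 < ε := by exact_mod_cast hε0
  have hfreq := frequently_lt_of_lt_limsup (by isBoundedDefault) hε
  obtain ⟨k, hk1, hk2⟩ := (hfreq.and_eventually
    (hv.tendsto.eventually_lt_const (mul_pos hpos hε0))).exists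
  have hk1 : ε < ∫ x, (V₁ x - V₀ x) * vk k x ^ 2 := by exact_mod_cast hk1
  have hi₀ := integrable_mul_test_sq hV₀ (hv.test k)
  have hi₁ := integrable_mul_test_sq hV₁ (hv.test k)
  simp_rw [sub_mul] at hk1
  rw [integral_sub hi₁ hi₀] at hk1
  rw [Q_eq hV₀ (hv.test k)] at hk2
  have hle := lam_mul_le (V := V₁) (hv.test k).memD12
  have hnn : 0 ≤ ∫ x, ‖∇ (vk k) x‖ ^ 2 := integral_nonneg fun x => by positivity
  set a := ∫ x, V₁ x * vk k x ^ 2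
  have hlt : ∫ x, ‖∇ (vk k) x‖ ^ 2 < Lam V₀ * a := by nlinarith
  have ha : 0 < a := (mul_pos_iff_of_pos_left hpos).1 (hnn.trans_lt hlt)
  exact lt_of_mul_lt_mul_right (hle.trans_lt hlt) ha.le

/-- Weak convergence in `L²` of `v_k` to a positive `v` bounds `∫_K v_k` from below on a compact
set `K` where `V₁ - V₀` is bounded from below, and hence `∫_K (V₁ - V₀) v_k²`. -/
lemma IsGroundStateVia.limsupInt_pos (hN : 3 ≤ N) {V₀ V₁ : RN N → ℝ}
    (hV₀ : LocallyIntegrable V₀ volume) (hV₁ : LocallyIntegrable V₁ volume)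
    (hle : ∀ᵐ x, V₀ x ≤ V₁ x) (hlt : 0 < volume {x | V₀ x < V₁ x}) {Z : Set (RN N)}
    {v : RN N → ℝ} {G : RN N → RN N} {vk : ℕ → RN N → ℝ} (h : IsGroundStateVia V₀ Z v G vk) :
    0 < limsupInt (fun x => V₁ x - V₀ x) vk := by
  have hZ := h.capZero.measure_eq_zero hN
  have hW : LocallyIntegrable (fun x => V₁ x - V₀ x) volume := hV₁.sub hV₀
  -- a level set of `V₁ - V₀` of positive measure
  obtain ⟨c, hc, hcpos⟩ : ∃ c : ℝ, 0 < c ∧ 0 < volume ({x | c < V₁ x - V₀ x} \ Z) := by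
    have hU : {x | V₀ x < V₁ x} ⊆ ⋃ n : ℕ, {x | (1 : ℝ) / (n + 1) < V₁ x - V₀ x} := fun x hx => by
      obtain ⟨n, hn⟩ := exists_nat_one_div_lt (sub_pos.2 (show V₀ x < V₁ x from hx))
      exact mem_iUnion.2 ⟨n, hn⟩
    obtain ⟨n, hn⟩ := exists_measure_pos_of_not_measure_iUnion_null
      (hlt.trans_le (measure_mono hU)).ne'
    exact ⟨1 / (n + 1), by positivity, by rwa [measure_sdiff_null hZ]⟩
  obtain ⟨K, hKs, hK, hKpos⟩ := exists_isCompact_subset_measure_pos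
    (NullMeasurableSet.diff
      (nullMeasurableSet_lt aemeasurable_const hW.aestronglyMeasurable.aemeasurable)
      h.capZero.1.measurableSet.nullMeasurableSet) hcpos
  have hKZ : K ⊆ Zᶜ := fun x hx => (hKs hx).2
  have hfin : IsFiniteMeasure (volume.restrict K) := ⟨by simpa using hK.measure_lt_top⟩
  have hvint : IntegrableOn v K := (h.solution.memH1loc.memLp K hK hKZ).integrable (by norm_num)
  have hvpos : ∀ᵐ x ∂volume.restrict K, 0 < v x :=
    ae_restrict_of_ae_restrict_of_subset hKZ h.solution.pos
  set m := ∫ x in K, v x with hm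
  have hm0 : 0 < m := by
    rw [hm, integral_pos_iff_support_of_nonneg_ae (hvpos.mono fun x hx => hx.le) hvint]
    rw [measure_congr (t := univ) (by
      filter_upwards [hvpos] with x hx
      exact propext ⟨fun _ => trivial, fun _ => hx.ne'⟩)]
    simpa using hKpos
  have hconv := (h.conv K hK hKZ).1 (fun _ => 1) (memLp_const 1)
  simp only [mul_one] at hconv
  set μ := volume.real K with hμ
  have hμ0 : 0 < μ := ENNReal.toReal_pos hKpos.ne' hK.measure_lt_top.ne
  have hev : ∀ᶠ k in atTop, c * (m ^ 2 / (4 * μ)) ≤ ∫ x, (V₁ x - V₀ x) * vk k x ^ 2 := by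
    filter_upwards [hconv.eventually_const_lt (half_lt_self hm0)] with k hk
    have hT := h.nullSeq.test k
    have hcont : ∀ f : RN N → ℝ, Continuous f → IntegrableOn f K := fun f hf =>
      hf.continuousOn.integrableOn_compact hK
    -- `v_k² ≥ 2 t v_k - t²` with `t` the lower bound `m / (2 μ)` for the mean of `v_k` over `K`
    have hsq : m ^ 2 / (4 * μ) ≤ ∫ x in K, vk k x ^ 2 := by
      set t := m / (2 * μ) with ht
      have h1 : ∫ x in K, (2 * t * vk k x - t ^ 2) ≤ ∫ x in K, vk k x ^ 2 :=
        integral_mono (hcont _ (by have := hT.continuous; fun_prop)) (hcont _ (hT.continuous.pow 2))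
          fun x => by nlinarith [sq_nonneg (vk k x - t)]
      rw [integral_sub ((hcont _ hT.continuous).const_mul _) (integrable_const _),
        integral_const_mul, setIntegral_const, smul_eq_mul, ← hμ] at h1
      have ht0 : 0 < t := by positivity
      have h2 : m ^ 2 / (4 * μ) = 2 * t * (m / 2) - μ * t ^ 2 := by
        rw [ht]; field_simp; ring
      rw [h2]
      nlinarith
    calc c * (m ^ 2 / (4 * μ)) ≤ c * ∫ x in K, vk k x ^ 2 := by gcongr
      _ = ∫ x in K, c * vk k x ^ 2 := (integral_const_mul _ _).symm
      _ ≤ ∫ x in K, (V₁ x - V₀ x) * vk k x ^ 2 := by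
          refine setIntegral_mono_on ((hcont _ (hT.continuous.pow 2)).const_mul _)
            (integrable_mul_test_sq hW hT).integrableOn hK.measurableSet fun x hx => ?_
          exact mul_le_mul_of_nonneg_right (le_of_lt (hKs hx).1) (sq_nonneg _)
      _ ≤ ∫ x, (V₁ x - V₀ x) * vk k x ^ 2 := by
          refine setIntegral_le_integral (integrable_mul_test_sq hW hT) ?_
          filter_upwards [hle] with x hx
          exact mul_nonneg (sub_nonneg.2 hx) (sq_nonneg _)
  refine lt_of_lt_of_le (b := ((c * (m ^ 2 / (4 * μ)) : ℝ) : EReal)) ?_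
    (le_limsup_of_frequently_le' (hev.mono fun k hk => ?_).frequently)
  · exact_mod_cast (by positivity : 0 < c * (m ^ 2 / (4 * μ)))
  · exact_mod_cast hk

end HardyGS

end

theorem mainTheorem5 (N : ℕ) (hN : 3 ≤ N) (V₀ V₁ : HardyGS.RN N → ℝ)
    (hV₀ : HardyGS.MemLorentz ((N : ℝ) / 2) V₀) (hV₁ : HardyGS.MemLorentz ((N : ℝ) / 2) V₁)
    (hpos₀ : 0 < volume {x | 0 < V₀ x}) (hpos₁ : 0 < volume {x | 0 < V₁ x})
    (hweak : HardyGS.WeaklyContinuousD12 (fun x => V₁ x - V₀ x))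
    (hground : ∃ v : HardyGS.RN N → ℝ, HardyGS.IsGroundState V₀ v) :
    ((∀ vk : ℕ → HardyGS.RN N → ℝ, HardyGS.IsNullSeq V₀ vk →
        0 < HardyGS.limsupInt (fun x => V₁ x - V₀ x) vk) →
      HardyGS.Lam V₁ < HardyGS.Lam V₀ ∧ ∃ u, HardyGS.IsMinimizer V₁ u) ∧
    ((∀ᵐ x, V₀ x ≤ V₁ x) → 0 < volume {x | V₀ x < V₁ x} →
      (∀ Z v G vk, HardyGS.IsGroundStateVia V₀ Z v G vk →
        0 < HardyGS.limsupInt (fun x => V₁ x - V₀ x) vk) ∧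
      HardyGS.Lam V₁ < HardyGS.Lam V₀ ∧ ∃ u, HardyGS.IsMinimizer V₁ u) := by
  open HardyGS in
  obtain ⟨K₀, hK₀⟩ := hV₀.exists_formBounded hN
  obtain ⟨K₁, hK₁⟩ := hV₁.exists_formBounded hN
  have hloc₀ := hV₀.locallyIntegrable
  have hloc₁ := hV₁.locallyIntegrable
  obtain ⟨v, Z, G, vk, hvia⟩ := hground
  have hmain : 0 < limsupInt (fun x => V₁ x - V₀ x) vk →
      Lam V₁ < Lam V₀ ∧ ∃ u, IsMinimizer V₁ u := fun h => by
    have hlt := lam_lt_of_isNullSeq hloc₀ hloc₁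
      (lam_pos hK₀ (exists_test_integral_pos hloc₀ hpos₀)) hvia.nullSeq h
    exact ⟨hlt, exists_isMinimizer_of_lam_lt hN hK₀ hK₁ hweak
      (exists_test_integral_pos hloc₁ hpos₁) hlt⟩
  refine ⟨fun h => hmain (h vk hvia.nullSeq), fun hle hlt => ?_⟩
  have hvpos : ∀ Z v G vk, IsGroundStateVia V₀ Z v G vk →
      0 < limsupInt (fun x => V₁ x - V₀ x) vk :=
    fun Z v G vk h => h.limsupInt_pos hN hloc₀ hloc₁ hle hlt
  exact ⟨hvpos, hmain (hvpos Z v G vk hvia)⟩
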